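/- Let $\mathcal H$ be a complex Hilbert space and let $(U_t)_{t\in\mathbb R}$ be a strongly continuous unitary one-parameter group on $\mathcal H$. Let $E$ be its spectral measure, i.e. the unique projection-valued Borel measure on $\mathbb R$ with $U_t=\int_{\mathbb R}e^{it\lambda}\,dE(\lambda)$ for all $t\in\mathbb R$ (it exists and is unique, and this is part of the assertion). Then the following four conditions are equivalent. (i) There exists an anti-unitary involution $J$ on $\mathcal H$ (a bijective antilinear isometry with $J^2=\mathbf 1$) such that $JU_tJ=U_t$ for all $t\in\mathbb R$. (ii) Put $\mathcal H_+:=E((0,\infty))\mathcal H$ and $\mathcal H_-:=E((-\infty,0))\mathcal H$, which are $U$-invariant. The unitary one-parameter groups $U^+_t:=U_t|_{\mathcal H_+}$ and $U^-_t:=U_{-t}|_{\mathcal H_-}$ are unitarily equivalent. (iii) There exist a complex Hilbert space $\mathcal V$ and a positive definite function $\psi:\mathbb R\to B(\mathcal V)$ that is symmetric, $\psi(-t)=\psi(t)$ for all $t\in\mathbb R$, such that $U$ is unitarily equivalent to the GNS representation $(\pi_\psi,\mathcal H_\psi)$. Here $\psi$ is positive definite if $\sum_{j,k}\langle \psi(t_j-t_k)v_k,v_j\rangle\ge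 0$ for all finite families $t_1,\dots,t_n\in\mathbb R$ and $v_1,\dots,v_n\in\mathcal V$ (with $\langle\cdot,\cdot\rangle$ linear in the first argument), $\mathcal H_\psi\subseteq\mathcal V^{\mathbb R}$ is the reproducing kernel Hilbert space with the $B(\mathcal V)$-valued kernel $K(s,t)=\psi(s-t)$, and $(\pi_\psi(t)f)(s)=f(s+t)$ for $f\in\mathcal H_\psi$, $s,t\in\mathbb R$. (iv) There exists a unitary involution $R$ on $\mathcal H$ (a unitary operator with $R^2=\mathbf 1$) such that $RU_tR=U_{-t}$ for all $t\in\mathbb R$. -/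

import Mathlib

open MeasureTheory
open scoped InnerProductSpace ComplexConjugate ComplexOrder

universe u

noncomputable section

/-- A unitary representation of the additive group `ℝ` on `H` (no continuity is imposed here). -/
structure UnitaryRep (H : Type u) [NormedAddCommGroup H] [InnerProductSpace ℂ H] where
  toFun : ℝ → (H ≃ₗᵢ[ℂ] H)
  map_add : ∀ (s t : ℝ) (v : H), toFun (s + t) v = toFun s (toFun t v)

namespace UnitaryRep

instance instCoeFun {H : Type u} [NormedAddCommGroup H] [InnerProductSpace ℂ H] :
    CoeFun (UnitaryRep H) (fun _ => ℝ → (H ≃ₗᵢ[ℂ] H)) := ⟨UnitaryRep.toFun⟩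

/-- Strong continuity. -/
def IsStronglyContinuous {H : Type u} [NormedAddCommGroup H] [InnerProductSpace ℂ H]
    (U : UnitaryRep H) : Prop :=
  ∀ v : H, Continuous fun t : ℝ => U t v

theorem map_zero {H : Type u} [NormedAddCommGroup H] [InnerProductSpace ℂ H]
    (U : UnitaryRep H) (v : H) : U 0 v = v := by
  have h := U.map_add 0 0 v
  rw [add_zero] at h
  exact ((U 0).injective h).symm

/-- The time-reversed representation `t ↦ U (-t)`. -/
def reverse {H : Type u} [NormedAddCommGroup H] [InnerProductSpace ℂ H]
    (U : UnitaryRep H) : UnitaryRep H where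
  toFun t := U (-t)
  map_add s t v := by rw [neg_add, U.map_add]

/-- The restriction of a unitary representation to an invariant subspace. -/
def restrict {H : Type u} [NormedAddCommGroup H] [InnerProductSpace ℂ H]
    (U : UnitaryRep H) (K : Submodule ℂ H) (hK : ∀ t : ℝ, ∀ v ∈ K, U t v ∈ K) :
    UnitaryRep K where
  toFun t :=
    { toFun := fun v => ⟨U t v, hK t v v.2⟩
      invFun := fun v => ⟨U (-t) v, hK (-t) v v.2⟩
      map_add' := fun v w => Subtype.ext (by simp)
      map_smul' := fun c v => Subtype.ext (by simp)
      left_inv := fun v => Subtype.ext (by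
        change U (-t) (U t v) = v
        rw [← U.map_add, neg_add_cancel, U.map_zero])
      right_inv := fun v => Subtype.ext (by
        change U t (U (-t) v) = v
        rw [← U.map_add, add_neg_cancel, U.map_zero])
      norm_map' := fun v => (U t).norm_map v }
  map_add s t v := Subtype.ext (U.map_add s t v)

/-- Unitary equivalence of unitary representations of `ℝ`. -/
def Equivalent {H K : Type u} [NormedAddCommGroup H] [InnerProductSpace ℂ H]
    [NormedAddCommGroup K] [InnerProductSpace ℂ K] (U : UnitaryRep H) (W : UnitaryRep K) : Prop :=
  ∃ T : H ≃ₗᵢ[ℂ] K, ∀ (t : ℝ) (v : H), T (U t v) = W t (T v)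

end UnitaryRep

/-- A projection-valued (spectral) Borel measure on `ℝ`: a family of orthogonal projections on the
Hilbert space `H`, multiplicative, normalized and countably additive in the strong operator
topology. By convention non-measurable sets are sent to `0`. -/
structure SpectralMeasure (H : Type u) [NormedAddCommGroup H] [InnerProductSpace ℂ H]
    [CompleteSpace H] where
  proj : Set ℝ → (H →L[ℂ] H)
  not_measurable : ∀ B : Set ℝ, ¬ MeasurableSet B → proj B = 0
  isStarProjection : ∀ B : Set ℝ, MeasurableSet B → IsStarProjection (proj B)
  empty : proj ∅ = 0
  univ : proj Set.univ = 1
  inter : ∀ A B : Set ℝ, MeasurableSet A → MeasurableSet B → proj (A ∩ B) = proj A * proj B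
  hasSum_iUnion : ∀ f : ℕ → Set ℝ, (∀ n, MeasurableSet (f n)) →
    Pairwise (Function.onFun Disjoint f) →
    ∀ v : H, HasSum (fun n => proj (f n) v) (proj (⋃ n, f n) v)

namespace SpectralMeasure

theorem inner_proj {H : Type u} [NormedAddCommGroup H] [InnerProductSpace ℂ H]
    [CompleteSpace H] (E : SpectralMeasure H) {B : Set ℝ} (hB : MeasurableSet B) (v : H) :
    ⟪v, E.proj B v⟫_ℂ = ((‖E.proj B v‖ ^ 2 : ℝ) : ℂ) := by
  have h := E.isStarProjection B hB
  have h1 : E.proj B (E.proj B v) = E.proj B v := by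
    have := h.isIdempotentElem
    exact congrArg (fun T : H →L[ℂ] H => T v) this
  have h2 : ContinuousLinearMap.adjoint (E.proj B) = E.proj B := h.isSelfAdjoint
  have h3 : ⟪v, E.proj B (E.proj B v)⟫_ℂ = ⟪E.proj B v, E.proj B v⟫_ℂ := by
    rw [← ContinuousLinearMap.adjoint_inner_left, h2]
  rw [h1] at h3
  rw [h3, inner_self_eq_norm_sq_to_K]
  norm_cast

/-- The scalar measure `B ↦ ⟨v, E(B) v⟩ = ‖E(B) v‖²`. -/
def scalarMeasure {H : Type u} [NormedAddCommGroup H] [InnerProductSpace ℂ H]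
    [CompleteSpace H] (E : SpectralMeasure H) (v : H) : Measure ℝ :=
  Measure.ofMeasurable (fun B _ => ENNReal.ofReal (⟪v, E.proj B v⟫_ℂ).re)
    (by simp [E.empty])
    (by
      intro f hf hd
      have hs := (E.hasSum_iUnion f hf hd v).mapL (innerSL ℂ v)
      have hs' := Complex.hasSum_re hs
      simp only [innerSL_apply_apply] at hs'
      have hn : ∀ n, 0 ≤ (⟪v, E.proj (f n) v⟫_ℂ).re := fun n => by
        rw [E.inner_proj (hf n), Complex.ofReal_re]
        positivity
      rw [← hs'.tsum_eq, ENNReal.ofReal_tsum_of_nonneg hn hs'.summable])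

theorem scalarMeasure_apply {H : Type u} [NormedAddCommGroup H] [InnerProductSpace ℂ H]
    [CompleteSpace H] (E : SpectralMeasure H) (v : H) {B : Set ℝ} (hB : MeasurableSet B) :
    E.scalarMeasure v B = ENNReal.ofReal (⟪v, E.proj B v⟫_ℂ).re :=
  Measure.ofMeasurable_apply B hB

instance isFiniteMeasure_scalarMeasure {H : Type u} [NormedAddCommGroup H]
    [InnerProductSpace ℂ H] [CompleteSpace H] (E : SpectralMeasure H) (v : H) :
    IsFiniteMeasure (E.scalarMeasure v) :=
  ⟨by rw [E.scalarMeasure_apply v MeasurableSet.univ]; exact ENNReal.ofReal_lt_top⟩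

/-- The closed subspace `E(B)H`. -/
def range {H : Type u} [NormedAddCommGroup H] [InnerProductSpace ℂ H]
    [CompleteSpace H] (E : SpectralMeasure H) (B : Set ℝ) : Submodule ℂ H :=
  LinearMap.range (E.proj B : H →ₗ[ℂ] H)

/-- `E` is the spectral measure of `U`, that is, `U t = ∫ exp (i t λ) dE(λ)` in the weak sense (by
polarization it suffices to say so for the quadratic forms). -/
def IsSpectralMeasureOf {H : Type u} [NormedAddCommGroup H] [InnerProductSpace ℂ H]
    [CompleteSpace H] (E : SpectralMeasure H) (U : UnitaryRep H) : Prop :=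
  ∀ (t : ℝ) (v : H),
    ⟪v, U t v⟫_ℂ = ∫ x : ℝ, Complex.exp (t * x * Complex.I) ∂(E.scalarMeasure v)

theorem IsSpectralMeasureOf.commute {H : Type u} [NormedAddCommGroup H] [InnerProductSpace ℂ H]
    [CompleteSpace H] {E : SpectralMeasure H} {U : UnitaryRep H} (hE : E.IsSpectralMeasureOf U)
    {B : Set ℝ} (hB : MeasurableSet B) (s : ℝ) (v : H) :
    E.proj B (U s v) = U s (E.proj B v) := by
  have hmeas : ∀ w : H, E.scalarMeasure (U s w) = E.scalarMeasure w := by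
    intro w
    refine Measure.ext_of_charFun (funext fun t => ?_)
    rw [charFun_apply_real, charFun_apply_real, ← hE, ← hE, ← U.map_add, add_comm t s, U.map_add,
      LinearIsometryEquiv.inner_map_map]
  have hinner : ∀ w : H, ⟪U s w, E.proj B (U s w)⟫_ℂ = ⟪w, E.proj B w⟫_ℂ := by
    intro w
    have h := congrArg (fun μ : Measure ℝ => μ B) (hmeas w)
    simp only [E.scalarMeasure_apply _ hB] at h
    rw [E.inner_proj hB, E.inner_proj hB] at h ⊢
    rw [Complex.ofReal_re, Complex.ofReal_re,
      ENNReal.ofReal_eq_ofReal_iff (by positivity) (by positivity)] at h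
    rw [h]
  have hop : (((U s).symm.toLinearEquiv : H →ₗ[ℂ] H) ∘ₗ (E.proj B : H →ₗ[ℂ] H) ∘ₗ
      ((U s).toLinearEquiv : H →ₗ[ℂ] H)) = (E.proj B : H →ₗ[ℂ] H) := by
    rw [← ext_inner_map]
    intro w
    have h1 : ⟪w, (U s).symm (E.proj B (U s w))⟫_ℂ = ⟪w, E.proj B w⟫_ℂ := by
      rw [← hinner w, ← LinearIsometryEquiv.inner_map_map (U s), LinearIsometryEquiv.apply_symm_apply]
    have h2 := congrArg (starRingEnd ℂ) h1
    simp only [inner_conj_symm] at h2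
    exact h2
  have h := congrArg (fun T : H →ₗ[ℂ] H => U s (T v)) hop
  simpa using h

theorem IsSpectralMeasureOf.invariant {H : Type u} [NormedAddCommGroup H]
    [InnerProductSpace ℂ H] [CompleteSpace H] {E : SpectralMeasure H} {U : UnitaryRep H}
    (hE : E.IsSpectralMeasureOf U) {B : Set ℝ} (hB : MeasurableSet B) :
    ∀ s : ℝ, ∀ v ∈ E.range B, U s v ∈ E.range B := by
  rintro s _ ⟨w, rfl⟩
  exact ⟨U s w, hE.commute hB s w⟩

/-- The representation `t ↦ U t` on `E((0, ∞))H`. -/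
def IsSpectralMeasureOf.posPart {H : Type u} [NormedAddCommGroup H] [InnerProductSpace ℂ H]
    [CompleteSpace H] {E : SpectralMeasure H} {U : UnitaryRep H} (hE : E.IsSpectralMeasureOf U) :
    UnitaryRep (E.range (Set.Ioi 0)) :=
  U.restrict (E.range (Set.Ioi 0)) (hE.invariant measurableSet_Ioi)

/-- The representation `t ↦ U (-t)` on `E((-∞, 0))H`. -/
def IsSpectralMeasureOf.negPart {H : Type u} [NormedAddCommGroup H] [InnerProductSpace ℂ H]
    [CompleteSpace H] {E : SpectralMeasure H} {U : UnitaryRep H} (hE : E.IsSpectralMeasureOf U) :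
    UnitaryRep (E.range (Set.Iio 0)) :=
  U.reverse.restrict (E.range (Set.Iio 0)) (fun t => hE.invariant measurableSet_Iio (-t))

end SpectralMeasure

/-- The function `ψ : ℝ → B(V)` is positive definite: for all `t₁, …, tₙ` and `v₁, …, vₙ` the sum
`∑ j k, ⟨v j, ψ (t j - t k) (v k)⟩` is a nonnegative real number. -/
def IsPositiveDefinite {V : Type u} [NormedAddCommGroup V] [InnerProductSpace ℂ V]
    (ψ : ℝ → (V →L[ℂ] V)) : Prop :=
  ∀ (n : ℕ) (t : Fin n → ℝ) (v : Fin n → V),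
    (0 : ℂ) ≤ ∑ j, ∑ k, ⟪v j, ψ (t j - t k) (v k)⟫_ℂ

/-- The operator-valued kernel `(s, t) ↦ ψ (s - t)`. -/
def gnsKernel {V : Type u} [NormedAddCommGroup V] [InnerProductSpace ℂ V]
    (ψ : ℝ → (V →L[ℂ] V)) : Matrix ℝ ℝ (V →L[ℂ] V) :=
  Matrix.of fun s t => ψ (s - t)

theorem IsPositiveDefinite.posSemidef {V : Type u} [NormedAddCommGroup V] [InnerProductSpace ℂ V]
    [CompleteSpace V] {ψ : ℝ → (V →L[ℂ] V)} (hψ : IsPositiveDefinite ψ) :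
    (gnsKernel ψ).PosSemidef := by
  have key : ∀ vv : ℝ →₀ V,
      (0 : ℂ) ≤ ∑ x ∈ vv.support, ∑ y ∈ vv.support, ⟪vv x, ψ (x - y) (vv y)⟫_ℂ := by
    intro vv
    have h := hψ vv.support.card (fun i => (vv.support.equivFin.symm i : ℝ))
      (fun i => vv (vv.support.equivFin.symm i : ℝ))
    have e : ∀ g : ℝ → ℂ,
        ∑ i, g (vv.support.equivFin.symm i : ℝ) = ∑ x ∈ vv.support, g x := fun g => by
      rw [Equiv.sum_comp vv.support.equivFin.symm (fun x : vv.support => g x)]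
      exact Finset.sum_coe_sort vv.support g
    rw [← e fun x => ∑ y ∈ vv.support, ⟪vv x, ψ (x - y) (vv y)⟫_ℂ]
    refine h.trans_eq (Finset.sum_congr rfl fun i _ => ?_)
    exact e fun y => ⟪vv (vv.support.equivFin.symm i : ℝ),
      ψ ((vv.support.equivFin.symm i : ℝ) - y) (vv y)⟫_ℂ
  have diag : ∀ x : V, (⟪x, ψ 0 x⟫_ℂ).im = 0 := fun x => by
    have h := hψ 1 (fun _ => 0) (fun _ => x)
    simp only [Fin.sum_univ_one, sub_zero] at h
    exact (Complex.le_def.mp h).2.symm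
  have im0 : ∀ (a : ℝ) (x y : V), (⟪x, ψ a y⟫_ℂ + ⟪y, ψ (-a) x⟫_ℂ).im = 0 := fun a x y => by
    have h := hψ 2 ![a, 0] ![x, y]
    simp only [Fin.sum_univ_two, Fin.isValue, Matrix.cons_val_zero, Matrix.cons_val_one,
      sub_self, sub_zero, zero_sub] at h
    have h2 := (Complex.le_def.mp h).2
    simp only [Complex.add_im, Complex.zero_im, diag] at h2
    rw [Complex.add_im]
    linarith
  have symm : ∀ (a : ℝ) (x y : V), ⟪x, ψ a y⟫_ℂ = starRingEnd ℂ ⟪y, ψ (-a) x⟫_ℂ := fun a x y => by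
    have h1 := im0 a x y
    have h2 := im0 a x (Complex.I • y)
    rw [map_smul, inner_smul_right, inner_smul_left] at h2
    simp only [Complex.add_im, Complex.mul_im, Complex.I_re, Complex.I_im, Complex.conj_I,
      Complex.neg_re, Complex.neg_im] at h1 h2
    apply Complex.ext
    · rw [Complex.conj_re]; linarith
    · rw [Complex.conj_im]; linarith
  have herm : (gnsKernel ψ).IsHermitian := by
    refine Matrix.ext fun s t => ?_
    change ContinuousLinearMap.adjoint (ψ (t - s)) = ψ (s - t)
    refine ContinuousLinearMap.ext fun y => ext_inner_left ℂ fun x => ?_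
    rw [ContinuousLinearMap.adjoint_inner_right, symm (s - t), neg_sub, inner_conj_symm]
  have tf := ((RKHS.posSemidef_tfae (K := gnsKernel ψ)).out 0 2 :
    (gnsKernel ψ).PosSemidef ↔ (gnsKernel ψ).IsHermitian ∧ ∀ (vv : ℝ →₀ V),
      0 ≤ RCLike.re (vv.sum fun x w ↦ vv.sum fun x' w' ↦ ⟪gnsKernel ψ x' x w, w'⟫_ℂ))
  refine tf.mpr ⟨herm, fun vv => ?_⟩
  have h := (Complex.le_def.mp (key vv)).1
  refine h.trans_eq ?_
  rw [Finset.sum_comm, Finsupp.sum]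
  simp only [Finsupp.sum, Complex.re_sum, map_sum]
  refine Finset.sum_congr rfl fun x _ => Finset.sum_congr rfl fun y _ => ?_
  exact inner_re_symm (𝕜 := ℂ) _ _

instance instFactPosSemidef {V : Type u} [NormedAddCommGroup V] [InnerProductSpace ℂ V]
    [CompleteSpace V] (ψ : ℝ → (V →L[ℂ] V)) [hψ : Fact (IsPositiveDefinite ψ)] :
    Fact (gnsKernel ψ).PosSemidef := ⟨hψ.out.posSemidef⟩

/-- The reproducing kernel Hilbert space (consisting of functions `ℝ → V`) with kernel
`(s, t) ↦ ψ (s - t)`. -/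
abbrev GNSSpace {V : Type u} [NormedAddCommGroup V] [InnerProductSpace ℂ V]
    [CompleteSpace V] (ψ : ℝ → (V →L[ℂ] V)) [Fact (IsPositiveDefinite ψ)] : Type u :=
  RKHS.OfKernel (gnsKernel ψ)

/-- The right translation operators act unitarily on the reproducing kernel space. -/
theorem GNSSpace.exists_translation {V : Type u} [NormedAddCommGroup V] [InnerProductSpace ℂ V]
    [CompleteSpace V] (ψ : ℝ → (V →L[ℂ] V)) [Fact (IsPositiveDefinite ψ)] (t : ℝ) :
    ∃ T : GNSSpace ψ ≃ₗᵢ[ℂ] GNSSpace ψ, ∀ (f : GNSSpace ψ) (s : ℝ), (T f) s = f (s + t) := by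
  let σ : ℝ × V ≃ ℝ × V := (Equiv.subRight t).prodCongr (Equiv.refl V)
  let κ : ℝ × V → GNSSpace ψ := fun p => RKHS.kerFun (GNSSpace ψ) p.1 p.2
  let A : (ℝ × V →₀ ℂ) →ₗ[ℂ] GNSSpace ψ := Finsupp.linearCombination ℂ κ
  let F : (ℝ × V →₀ ℂ) ≃ₗ[ℂ] (ℝ × V →₀ ℂ) := Finsupp.domLCongr σ
  have hF : ∀ x, A (F x) = Finsupp.linearCombination ℂ (κ ∘ σ) x := fun x => by
    simp only [A, F, Finsupp.domLCongr_apply, Finsupp.domCongr_apply]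
    exact Finsupp.linearCombination_equivMapDomain ℂ σ x
  have hdense : DenseRange A := by
    have h := RKHS.kerFun_dense (GNSSpace ψ)
    rw [← Submodule.dense_iff_topologicalClosure_eq_top] at h
    refine h.mono (fun f hf => ?_)
    have h2 : f ∈ LinearMap.range A := by
      rw [Finsupp.range_linearCombination]
      refine Submodule.span_mono ?_ hf
      rintro _ ⟨x, v, rfl⟩
      exact ⟨(x, v), rfl⟩
    exact h2
  have hκ : ∀ p q : ℝ × V, ⟪κ (σ p), κ (σ q)⟫_ℂ = ⟪κ p, κ q⟫_ℂ := fun p q => by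
    simp only [κ, ← RKHS.kernel_inner, RKHS.OfKernel.kernel_ofKernel]
    change ⟪ψ ((q.1 - t) - (p.1 - t)) p.2, q.2⟫_ℂ = ⟪ψ (q.1 - p.1) p.2, q.2⟫_ℂ
    rw [sub_sub_sub_cancel_right]
  have hnorm : ∀ x, ‖A (F x)‖ = ‖A x‖ := fun x => by
    have h : ⟪A (F x), A (F x)⟫_ℂ = ⟪A x, A x⟫_ℂ := by
      rw [hF]
      simp only [A, Finsupp.linearCombination_apply, Finsupp.sum_inner, Finsupp.inner_sum,
        Function.comp_apply, inner_smul_left, inner_smul_right, hκ]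
    rw [inner_self_eq_norm_sq_to_K, inner_self_eq_norm_sq_to_K] at h
    have h2 : ‖A (F x)‖ ^ 2 = ‖A x‖ ^ 2 := by exact_mod_cast h
    exact (sq_eq_sq₀ (norm_nonneg _) (norm_nonneg _)).mp h2
  refine ⟨F.extendOfIsometry A A hdense hdense hnorm, fun f s => ?_⟩
  refine hdense.induction_on (p := fun f =>
    (F.extendOfIsometry A A hdense hdense hnorm f) s = f (s + t)) f ?_ ?_
  · exact isClosed_eq ((RKHS.continuous_eval s).comp (LinearIsometryEquiv.continuous _))
      (RKHS.continuous_eval (s + t))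
  · intro x
    rw [LinearEquiv.extendOfIsometry_eq, hF]
    induction x using Finsupp.induction_linear with
    | zero => simp
    | add x y hx hy => simp only [map_add, RKHS.coe_add, Pi.add_apply, hx, hy]
    | single p c =>
      simp only [A, Finsupp.linearCombination_single, RKHS.coe_smul, Pi.smul_apply,
        Function.comp_apply, κ, RKHS.kerFun_apply, RKHS.OfKernel.kernel_ofKernel]
      change c • ψ (s - (p.1 - t)) p.2 = c • ψ (s + t - p.1) p.2
      rw [sub_sub_eq_add_sub]

/-- The GNS representation of `ℝ` on the reproducing kernel space of `ψ`, by right translations: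
`(π t f) s = f (s + t)`. -/
def gnsRep {V : Type u} [NormedAddCommGroup V] [InnerProductSpace ℂ V]
    [CompleteSpace V] (ψ : ℝ → (V →L[ℂ] V)) [Fact (IsPositiveDefinite ψ)] :
    UnitaryRep (GNSSpace ψ) where
  toFun t := Classical.choose (GNSSpace.exists_translation ψ t)
  map_add s t f := by
    refine RKHS.ext fun x => ?_
    rw [Classical.choose_spec (GNSSpace.exists_translation ψ (s + t)),
      Classical.choose_spec (GNSSpace.exists_translation ψ s),
      Classical.choose_spec (GNSSpace.exists_translation ψ t), add_assoc]

theorem gnsRep_apply {V : Type u} [NormedAddCommGroup V] [InnerProductSpace ℂ V]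
    [CompleteSpace V] (ψ : ℝ → (V →L[ℂ] V)) [Fact (IsPositiveDefinite ψ)] (t : ℝ)
    (f : GNSSpace ψ) (s : ℝ) : (gnsRep ψ t f) s = f (s + t) :=
  Classical.choose_spec (GNSSpace.exists_translation ψ t) f s

end

noncomputable section

open Filter Topology

/-! The equivalences rest on time reversal. A unitary `W` with `W U_t = U_{-t} W` reflects the
spectrum at `0`, so it restricts to an equivalence of the two spectral parts
(`equivalent_of_reversing`). The involution in (iv) is such a `W`. The `J` in (i) becomes one after
composition with an antiunitary `C` satisfying `C U_t = U_{-t} C`. Such a `C` always exists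
(`exists_conjugation`): on a cyclic subspace `U_t v ↦ U_{-t} v` conjugates the Gram matrix, and
cyclic subspaces exhaust the space orthogonally.

Conversely, let `T` map the positive part onto the reversed negative part. Acting by `T C` on the
positive part, `C T⁻¹` on the negative part and `C` on the invariant vectors gives an involution
(`exists_involution`). For the identity in place of `C` it is a unitary `R` reversing time; for the
conjugation it is an antiunitary commuting with `U`.

For the GNS condition, put `A = 1 + R` and `ψ(t) = A† U_t A`. Symmetry follows from `R A = A`. The
range of `A` is cyclic because spectral projections of `A x` recover `x` when `x` lies in the
positive or negative part, while `A = 2` on invariant vectors (`exists_symmetric_gnsRep`). In the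
other direction, `f ↦ f(-·)` is unitary on the kernel space of a symmetric `ψ`
(`exists_reflection`).

The spectral measure comes from Bochner's theorem (`exists_measure_charFun_eq`), proved by finite
Fourier transforms of sampled orbits and a tightness argument. The measures are then polarized;
Fourier uniqueness for complex combinations of measures (`charFunGraph_unique`) turns identities
between matrix coefficients into sesquilinearity and multiplicativity of the projections. -/

/-! ### Gram matrices, cyclic subspaces and time-reversing conjugations. -/

/-- A family with dense span and its image under an (anti)unitary change of Gram matrix are related
by a semilinear isometric equivalence. -/
theorem exists_linearIsometryEquiv_of_inner_eq {σ : ℂ →+* ℂ} [RingHomInvPair σ σ]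
    (hreal : ∀ r : ℝ, σ r = r) (hconj : ∀ z : ℂ, σ (conj z) = conj (σ z))
    {ι H K : Type*} [NormedAddCommGroup H] [InnerProductSpace ℂ H] [CompleteSpace H]
    [NormedAddCommGroup K] [InnerProductSpace ℂ K] [CompleteSpace K]
    (κ : ι → H) (κ' : ι → K) (hκ : Dense (Submodule.span ℂ (Set.range κ) : Set H))
    (hκ' : Dense (Submodule.span ℂ (Set.range κ') : Set K))
    (h : ∀ p q, ⟪κ' p, κ' q⟫_ℂ = σ ⟪κ p, κ q⟫_ℂ) :
    ∃ T : H ≃ₛₗᵢ[σ] K, ∀ p, T (κ p) = κ' p := by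
  have hσσ : ∀ z, σ (σ z) = z := fun z => RingHomInvPair.comp_apply_eq (σ := σ) (σ' := σ)
  have hmap : ∀ x : ι →₀ ℂ, Finsupp.mapRange σ σ.map_zero (Finsupp.mapRange σ σ.map_zero x) = x :=
    fun x => Finsupp.ext fun p => by simp [hσσ]
  let F : (ι →₀ ℂ) ≃ₛₗ[σ] (ι →₀ ℂ) :=
    { toFun := Finsupp.mapRange σ σ.map_zero
      invFun := Finsupp.mapRange σ σ.map_zero
      map_add' := fun x y => Finsupp.ext fun p => by simp
      map_smul' := fun c x => Finsupp.ext fun p => by simp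
      left_inv := hmap
      right_inv := hmap }
  let A : (ι →₀ ℂ) →ₗ[ℂ] H := Finsupp.linearCombination ℂ κ
  let A' : (ι →₀ ℂ) →ₗ[ℂ] K := Finsupp.linearCombination ℂ κ'
  have hA : DenseRange A := by
    change Dense ((LinearMap.range A : Submodule ℂ H) : Set H)
    rwa [Finsupp.range_linearCombination]
  have hA' : DenseRange A' := by
    change Dense ((LinearMap.range A' : Submodule ℂ K) : Set K)
    rwa [Finsupp.range_linearCombination]
  have hF : ∀ x, A' (F x) = x.sum fun p c => σ c • κ' p := fun x => by
    change Finsupp.linearCombination ℂ κ' (Finsupp.mapRange σ σ.map_zero x) = _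
    rw [Finsupp.linearCombination_apply, Finsupp.sum_mapRange_index (by simp)]
  -- The Gram relation yields only `σ` of the squared norm, which is harmless because `σ` fixes the
  -- reals.
  have hnorm : ∀ x, ‖A' (F x)‖ = ‖A x‖ := fun x => by
    have h1 : ⟪A' (F x), A' (F x)⟫_ℂ = σ ⟪A x, A x⟫_ℂ := by
      rw [hF]
      simp only [A, Finsupp.linearCombination_apply, Finsupp.sum, sum_inner, inner_sum,
        inner_smul_left, inner_smul_right, h, map_sum, map_mul, hconj]
    rw [inner_self_eq_norm_sq_to_K, inner_self_eq_norm_sq_to_K] at h1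
    have h2 : σ (((‖A x‖ : ℝ) : ℂ) ^ 2) = ((‖A x‖ : ℝ) : ℂ) ^ 2 := by rw [map_pow, hreal]
    have h3 : ‖A' (F x)‖ ^ 2 = ‖A x‖ ^ 2 := by
      refine Complex.ofReal_injective ?_
      push_cast
      exact h1.trans h2
    exact (sq_eq_sq₀ (norm_nonneg _) (norm_nonneg _)).mp h3
  refine ⟨F.extendOfIsometry A A' hA hA' hnorm, fun p => ?_⟩
  have h1 : A (Finsupp.single p 1) = κ p := by simp [A]
  rw [← h1, LinearEquiv.extendOfIsometry_eq, hF, Finsupp.sum_single_index] <;> simp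

namespace UnitaryRep

variable {H : Type u} [NormedAddCommGroup H] [InnerProductSpace ℂ H]

theorem neg_apply (U : UnitaryRep H) (t : ℝ) (v : H) : U (-t) (U t v) = v := by
  rw [← U.map_add, neg_add_cancel, U.map_zero]

theorem apply_neg (U : UnitaryRep H) (t : ℝ) (v : H) : U t (U (-t) v) = v := by
  rw [← U.map_add, add_neg_cancel, U.map_zero]

theorem inner_apply_right (U : UnitaryRep H) (t : ℝ) (v w : H) :
    ⟪v, U t w⟫_ℂ = ⟪U (-t) v, w⟫_ℂ := by
  rw [← (U (-t)).inner_map_map v, U.neg_apply]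

theorem inner_apply_apply (U : UnitaryRep H) (s t : ℝ) (v w : H) :
    ⟪U s v, U t w⟫_ℂ = ⟪v, U (t - s) w⟫_ℂ := by
  rw [U.inner_apply_right (t - s), ← (U s).inner_map_map _ w, U.inner_apply_right t,
    ← (U t).inner_map_map, U.apply_neg]
  rw [U.inner_apply_right t, U.inner_apply_right s, ← U.map_add, ← U.map_add, ← U.map_add]
  congr 2
  ring_nf

/-- A set of vectors generating pairwise orthogonal cyclic subspaces. -/
def IsCyclicOrthogonal (U : UnitaryRep H) (S : Set H) : Prop :=
  ∀ v ∈ S, ∀ w ∈ S, v ≠ w → ∀ t : ℝ, ⟪v, U t w⟫_ℂ = 0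

/-- `H` is the closed span of pairwise orthogonal cyclic subspaces. -/
theorem exists_isCyclicOrthogonal [CompleteSpace H] (U : UnitaryRep H) :
    ∃ S : Set H, U.IsCyclicOrthogonal S ∧
      Dense (Submodule.span ℂ (Set.range fun p : S × ℝ => U p.2 p.1) : Set H) := by
  obtain ⟨S, hS⟩ := zorn_subset {S : Set H | U.IsCyclicOrthogonal S} (fun c hc hchain => by
    refine ⟨⋃₀ c, ?_, fun s hs => Set.subset_sUnion_of_mem hs⟩
    rintro v ⟨A, hA, hv⟩ w ⟨B, hB, hw⟩ hvw t
    rcases hchain.total hA hB with hAB | hAB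
    · exact hc hB v (hAB hv) w hw hvw t
    · exact hc hA v hv w (hAB hw) hvw t)
  refine ⟨S, hS.prop, ?_⟩
  rw [Submodule.dense_iff_topologicalClosure_eq_top, Submodule.topologicalClosure_eq_top_iff,
    Submodule.eq_bot_iff]
  intro x hx
  have hx' : ∀ v ∈ S, ∀ t, ⟪x, U t v⟫_ℂ = 0 := fun v hv t =>
    (Submodule.mem_orthogonal' _ _).mp hx _ (Submodule.subset_span ⟨(⟨v, hv⟩, t), rfl⟩)
  have hins : U.IsCyclicOrthogonal (insert x S) := by
    rintro v (rfl | hv) w (rfl | hw) hvw t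
    · exact absurd rfl hvw
    · exact hx' w hw t
    · rw [U.inner_apply_right, ← inner_conj_symm, hx' v hv, _root_.map_zero]
    · exact hS.prop v hv w hw hvw t
  -- Maximality forces `x` itself into the family, so `x` is orthogonal to its own orbit, in
  -- particular to itself.
  have hmem : x ∈ S := hS.le_of_ge hins (Set.subset_insert _ _) (Set.mem_insert _ _)
  have := hx' x hmem 0
  rwa [U.map_zero, inner_self_eq_zero] at this

/-- Every unitary representation of `ℝ` admits a conjugation reversing time. -/
theorem exists_conjugation [CompleteSpace H] (U : UnitaryRep H) :
    ∃ C : H ≃ₗᵢ⋆[ℂ] H, (∀ v, C (C v) = v) ∧ ∀ (t : ℝ) (v : H), C (U t v) = U (-t) (C v) := by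
  obtain ⟨S, hS, hd⟩ := U.exists_isCyclicOrthogonal
  have hd' : Dense (Submodule.span ℂ (Set.range fun p : S × ℝ => U (-p.2) p.1) : Set H) := by
    convert hd using 3
    refine (Equiv.prodCongr (Equiv.refl S) (Equiv.neg ℝ)).surjective.range_comp
      (fun p : S × ℝ => U p.2 p.1)
  -- Within one orbit, negating both times conjugates `⟪v, U (t - s) v⟫`; between distinct orbits
  -- both Gram entries vanish.
  obtain ⟨C, hC⟩ := exists_linearIsometryEquiv_of_inner_eq (σ := starRingEnd ℂ) (by simp) (by simp)
    (fun p : S × ℝ => U p.2 (p.1 : H)) (fun p : S × ℝ => U (-p.2) (p.1 : H)) hd hd' (by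
      rintro ⟨v, s⟩ ⟨w, t⟩
      simp only [inner_apply_apply]
      by_cases hvw : (v : H) = w
      · rw [hvw, U.inner_apply_right (-t - -s), inner_conj_symm]
        congr 3
        ring
      · rw [hS v v.2 w w.2 hvw, hS v v.2 w w.2 hvw, _root_.map_zero])
  have hC' : ∀ (t : ℝ) (v : S), C (U t v) = U (-t) v := fun t v => hC (v, t)
  refine ⟨C, fun v => ?_, fun t v => ?_⟩
  · have h : ((C.toContinuousLinearEquiv : H →L⋆[ℂ] H).comp
        (C.toContinuousLinearEquiv : H →L⋆[ℂ] H)) = ContinuousLinearMap.id ℂ H := by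
      refine ContinuousLinearMap.ext_on hd ?_
      rintro _ ⟨⟨v, t⟩, rfl⟩
      change C (C (U t v)) = U t v
      rw [hC', hC', neg_neg]
    exact congrArg (fun T : H →L[ℂ] H => T v) h
  · have h : ((C.toContinuousLinearEquiv : H →L⋆[ℂ] H).comp
        ((U t).toContinuousLinearEquiv : H →L[ℂ] H)) =
        ((U (-t)).toContinuousLinearEquiv : H →L[ℂ] H).comp
          (C.toContinuousLinearEquiv : H →L⋆[ℂ] H) := by
      refine ContinuousLinearMap.ext_on hd ?_
      rintro _ ⟨⟨v, s⟩, rfl⟩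
      change C (U t (U s v)) = U (-t) (C (U s v))
      rw [← U.map_add, hC', hC', ← U.map_add, neg_add]
    exact congrArg (fun T : H →L⋆[ℂ] H => T v) h

end UnitaryRep

/-! ### Bochner's theorem for matrix coefficients, by discrete Fourier analysis. -/

namespace UnitaryRep

variable {H : Type u} [NormedAddCommGroup H] [InnerProductSpace ℂ H]

theorem norm_inner_apply_le (U : UnitaryRep H) {v : H} (hv : ‖v‖ = 1) (t : ℝ) :
    ‖⟪v, U t v⟫_ℂ‖ ≤ 1 := by
  have h := norm_inner_le_norm (𝕜 := ℂ) v (U t v)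
  rwa [(U t).norm_map, hv, one_mul] at h

/-- The discrete Fourier coefficient of the orbit `k ↦ U (h * k) v`. -/
def fourierVector (U : UnitaryRep H) (v : H) (h : ℝ) (N : ℕ) [NeZero N] (l : ZMod N) : H :=
  ((N : ℂ)⁻¹) • ∑ k ∈ Finset.range N, ZMod.stdAddChar (-(l * (k : ZMod N))) • U (h * k) v

/-- Parseval with a twist: expanding the square gives a double sum over `j`, `k`, and orthogonality
of the characters keeps only `k ≡ j + m` modulo `N`. The residue stays visible because the orbit
itself is not periodic. -/
theorem sum_norm_sq_fourierVector_mul (U : UnitaryRep H) (v : H) (h : ℝ) (N : ℕ) [NeZero N]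
    (m : ℕ) :
    ∑ l : ZMod N, ((‖U.fourierVector v h N l‖ ^ 2 : ℝ) : ℂ) * ZMod.stdAddChar (l * (m : ZMod N)) =
      (N : ℂ)⁻¹ * ∑ j ∈ Finset.range N, ⟪v, U (h * (((j + m) % N : ℕ) - (j : ℝ))) v⟫_ℂ := by
  have hN : (N : ℂ) ≠ 0 := Nat.cast_ne_zero.mpr (NeZero.ne N)
  have h1 : ∀ l : ZMod N, ((‖U.fourierVector v h N l‖ ^ 2 : ℝ) : ℂ) * ZMod.stdAddChar (l * (m : ZMod N)) =
      ∑ j ∈ Finset.range N, ∑ k ∈ Finset.range N,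
        ((N : ℂ)⁻¹ * (N : ℂ)⁻¹ * ⟪v, U (h * (k - (j : ℝ))) v⟫_ℂ) *
          ZMod.stdAddChar (l * ((j : ZMod N) + (m : ZMod N) - (k : ZMod N))) := by
    intro l
    have h2 : ((‖U.fourierVector v h N l‖ ^ 2 : ℝ) : ℂ) =
        ⟪U.fourierVector v h N l, U.fourierVector v h N l⟫_ℂ := by
      rw [inner_self_eq_norm_sq_to_K]
      norm_cast
    rw [h2]
    simp only [fourierVector, inner_smul_left, inner_smul_right, sum_inner, inner_sum,
      inner_apply_apply, Finset.mul_sum, Finset.sum_mul]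
    rw [Finset.sum_comm]
    refine Finset.sum_congr rfl fun j _ => Finset.sum_congr rfl fun k _ => ?_
    rw [← AddChar.map_neg_eq_conj, neg_neg]
    have e : l * ((j : ZMod N) + (m : ZMod N) - (k : ZMod N)) = l * j + -(l * k) + l * m := by ring
    rw [e, AddChar.map_add_eq_mul, AddChar.map_add_eq_mul, mul_sub]
    simp only [map_inv₀, map_natCast]
    ring
  simp only [h1]
  rw [Finset.sum_comm, Finset.mul_sum]
  refine Finset.sum_congr rfl fun j _ => ?_
  rw [Finset.sum_comm]
  simp only [← Finset.mul_sum]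
  have hlt : (j + m) % N < N := Nat.mod_lt _ (NeZero.pos N)
  rw [Finset.sum_eq_single_of_mem ((j + m) % N) (Finset.mem_range.mpr hlt)]
  · rw [AddChar.sum_mulShift _ (ZMod.isPrimitive_stdAddChar N)]
    simp only [ZMod.natCast_mod, Nat.cast_add, sub_self, if_true, ZMod.card]
    field_simp
  · intro k hk hne
    rw [AddChar.sum_mulShift _ (ZMod.isPrimitive_stdAddChar N), if_neg, Nat.cast_zero, mul_zero]
    intro h0
    apply hne
    have : ((k : ℕ) : ZMod N) = ((j + m : ℕ) : ZMod N) := by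
      rw [Nat.cast_add]; exact (sub_eq_zero.mp h0).symm
    rw [ZMod.natCast_eq_natCast_iff'] at this
    rw [← this, Nat.mod_eq_of_lt (Finset.mem_range.mp hk)]

/-- Only the indices with `j + m ≥ N` wrap around. There are at most `m` of them, each costs at most
`2`, and the average divides by `N`. -/
theorem norm_sum_fourierVector_sub_le (U : UnitaryRep H) {v : H} (hv : ‖v‖ = 1) (h : ℝ) (N : ℕ)
    [NeZero N] (m : ℕ) :
    ‖∑ l : ZMod N, ((‖U.fourierVector v h N l‖ ^ 2 : ℝ) : ℂ) * ZMod.stdAddChar (l * (m : ZMod N)) -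
      ⟪v, U (h * m) v⟫_ℂ‖ ≤ 2 * m / N := by
  have hN : (N : ℂ) ≠ 0 := Nat.cast_ne_zero.mpr (NeZero.ne N)
  have hN' : (0 : ℝ) < N := Nat.cast_pos.mpr (NeZero.pos N)
  rw [sum_norm_sq_fourierVector_mul]
  have h1 : ⟪v, U (h * m) v⟫_ℂ = (N : ℂ)⁻¹ * ∑ j ∈ Finset.range N, ⟪v, U (h * m) v⟫_ℂ := by
    rw [Finset.sum_const, Finset.card_range, nsmul_eq_mul]
    field_simp
  rw [h1, ← mul_sub, ← Finset.sum_sub_distrib, norm_mul, norm_inv, Complex.norm_natCast,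
    div_eq_inv_mul]
  refine mul_le_mul_of_nonneg_left ?_ (by positivity)
  have h2 : ∀ j ∈ Finset.range N, ‖⟪v, U (h * (((j + m) % N : ℕ) - (j : ℝ))) v⟫_ℂ -
      ⟪v, U (h * m) v⟫_ℂ‖ ≤ if N ≤ j + m then 2 else 0 := by
    intro j hj
    split_ifs with hjm
    · have a := U.norm_inner_apply_le hv (h * (((j + m) % N : ℕ) - (j : ℝ)))
      have b := U.norm_inner_apply_le hv (h * m)
      have c := norm_sub_le (⟪v, U (h * (((j + m) % N : ℕ) - (j : ℝ))) v⟫_ℂ) (⟪v, U (h * m) v⟫_ℂ)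
      linarith
    · rw [Nat.mod_eq_of_lt (not_le.mp hjm), Nat.cast_add, add_sub_cancel_left, sub_self, norm_zero]
  refine (norm_sum_le_of_le _ h2).trans ?_
  rw [← Finset.sum_filter, Finset.sum_const, nsmul_eq_mul]
  have h3 : ((Finset.range N).filter fun j => N ≤ j + m).card ≤ m := by
    calc ((Finset.range N).filter fun j => N ≤ j + m).card
        ≤ (Finset.Ico (N - m) N).card := by
          refine Finset.card_le_card fun j hj => ?_
          rw [Finset.mem_filter, Finset.mem_range] at hj
          rw [Finset.mem_Ico]
          omega
      _ ≤ m := by rw [Nat.card_Ico]; omega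
  have h4 : (((Finset.range N).filter fun j => N ≤ j + m).card : ℝ) ≤ m := by exact_mod_cast h3
  linarith

/-- A band-limited measure whose characteristic function approximates `t ↦ ⟪v, U t v⟫` on a
lattice. -/
theorem exists_measure_norm_charFun_sub_le (U : UnitaryRep H) {v : H} (hv : ‖v‖ = 1) {h : ℝ}
    (hh : 0 < h) (N : ℕ) [NeZero N] :
    ∃ μ : Measure ℝ, IsProbabilityMeasure μ ∧ (∀ᵐ x ∂μ, |h * x| ≤ Real.pi) ∧
      ∀ m : ℕ, ‖charFun μ (h * m) - ⟪v, U (h * m) v⟫_ℂ‖ ≤ 2 * m / N := by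
  -- Atoms sit at the frequencies of the characters; the principal argument is the choice that keeps
  -- `|h * x|` below `π`.
  let x : ZMod N → ℝ := fun l => Complex.arg (ZMod.stdAddChar l) / h
  let w : ZMod N → ENNReal := fun l => ENNReal.ofReal (‖U.fourierVector v h N l‖ ^ 2)
  let μ : Measure ℝ := ∑ l, w l • Measure.dirac (x l)
  have hx : ∀ l, h * x l = Complex.arg (ZMod.stdAddChar l) := fun l => by
    simp only [x]; field_simp
  have hchar : ∀ m : ℕ, charFun μ (h * m) =
      ∑ l : ZMod N, ((‖U.fourierVector v h N l‖ ^ 2 : ℝ) : ℂ) * ZMod.stdAddChar (l * (m : ZMod N)) := by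
    intro m
    rw [charFun_apply_real, integral_finsetSum_measure]
    · refine Finset.sum_congr rfl fun l _ => ?_
      rw [integral_smul_measure, integral_dirac, ENNReal.toReal_ofReal (by positivity),
        Complex.real_smul]
      congr 1
      have e : ((h * m : ℝ) : ℂ) * (x l : ℂ) * Complex.I =
          m * ((Complex.arg (ZMod.stdAddChar l) : ℝ) * Complex.I) := by
        rw [← hx l]; push_cast; ring
      rw [e, Complex.exp_nat_mul]
      have e2 := Complex.norm_mul_exp_arg_mul_I (ZMod.stdAddChar l)
      rw [AddChar.norm_apply, Complex.ofReal_one, one_mul] at e2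
      rw [e2, mul_comm l, ← nsmul_eq_mul, AddChar.map_nsmul_eq_pow]
    · intro l _
      refine (integrable_dirac (by simp)).smul_measure ENNReal.ofReal_ne_top
  have hfin : IsFiniteMeasure μ := by
    refine ⟨?_⟩
    simp only [μ, Measure.finsetSum_apply, Measure.smul_apply, smul_eq_mul, measure_univ, mul_one]
    exact ENNReal.sum_lt_top.mpr fun l _ => ENNReal.ofReal_lt_top
  refine ⟨μ, ⟨?_⟩, ?_, fun m => ?_⟩
  -- At `m = 0` the error bound is zero, so the total mass is exactly `‖v‖ ^ 2 = 1`.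
  · have h0 := U.norm_sum_fourierVector_sub_le hv h N 0
    rw [← hchar] at h0
    simp only [Nat.cast_zero, mul_zero, zero_div, norm_le_zero_iff, sub_eq_zero, U.map_zero,
      charFun_zero, inner_self_eq_norm_sq_to_K, hv] at h0
    have h1 : μ.real Set.univ = 1 := by
      apply Complex.ofReal_injective
      rw [h0]; simp
    rw [← ENNReal.ofReal_toReal (measure_ne_top μ Set.univ)]
    change ENNReal.ofReal (μ.real Set.univ) = 1
    rw [h1, ENNReal.ofReal_one]
  · rw [ae_iff]
    have hm : MeasurableSet {a : ℝ | ¬ |h * a| ≤ Real.pi} :=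
      (measurableSet_le (f := fun a : ℝ => |h * a|) (g := fun _ => Real.pi)
        (by fun_prop) (by fun_prop)).compl
    simp only [μ, Measure.finsetSum_apply, Measure.smul_apply, Measure.dirac_apply' _ hm]
    refine Finset.sum_eq_zero fun l _ => ?_
    rw [Set.indicator_of_notMem, smul_zero]
    simp only [Set.mem_ofPred_eq, not_not, hx]
    exact Complex.abs_arg_le_pi _
  · rw [hchar]
    exact U.norm_sum_fourierVector_sub_le hv h N m

end UnitaryRep

theorem norm_exp_ofReal_mul_I_sub_sq (a b : ℝ) :
    ‖Complex.exp (a * Complex.I) - Complex.exp (b * Complex.I)‖ ^ 2 = 2 - 2 * Real.cos (a - b) := by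
  rw [← Complex.normSq_eq_norm_sq, Complex.normSq_apply, Real.cos_sub]
  simp only [Complex.sub_re, Complex.sub_im, Complex.exp_ofReal_mul_I_re,
    Complex.exp_ofReal_mul_I_im]
  nlinarith [Real.sin_sq_add_cos_sq a, Real.sin_sq_add_cos_sq b]

/-- Bernstein-type estimate for the characteristic function of a band-limited measure. -/
theorem norm_charFun_sub_sq_le {μ : Measure ℝ} [IsProbabilityMeasure μ] {h s t : ℝ}
    (hμ : ∀ᵐ x ∂μ, |h * x| ≤ Real.pi) (hst : |t - s| ≤ h) :
    ‖charFun μ t - charFun μ s‖ ^ 2 ≤ 2 - 2 * (charFun μ h).re := by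
  have hint : ∀ r : ℝ, Integrable (fun x : ℝ => Complex.exp (r * x * Complex.I)) μ := fun r =>
    Integrable.of_bound (by fun_prop) 1 (ae_of_all _ fun x => by
      rw [← Complex.ofReal_mul, Complex.norm_exp_ofReal_mul_I])
  let f : ℝ → ℝ := fun x => ‖Complex.exp (t * x * Complex.I) - Complex.exp (s * x * Complex.I)‖
  have hf : MemLp f 2 μ := by
    refine MemLp.of_bound (by fun_prop) 2 (ae_of_all _ fun x => ?_)
    rw [norm_norm]
    refine (norm_sub_le _ _).trans ?_
    rw [← Complex.ofReal_mul, ← Complex.ofReal_mul, Complex.norm_exp_ofReal_mul_I,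
      Complex.norm_exp_ofReal_mul_I]
    norm_num
  have h1 : ‖charFun μ t - charFun μ s‖ ≤ ∫ x, f x ∂μ := by
    rw [charFun_apply_real, charFun_apply_real, ← integral_sub (hint t) (hint s)]
    exact norm_integral_le_integral_norm _
  -- Jensen's inequality, in the form that a variance is nonnegative.
  have h2 : (∫ x, f x ∂μ) ^ 2 ≤ ∫ x, f x ^ 2 ∂μ := by
    have := ProbabilityTheory.variance_nonneg f μ
    rw [ProbabilityTheory.variance_eq_sub hf] at this
    simp only [Pi.pow_apply] at this
    linarith
  have hcos : Integrable (fun x : ℝ => Real.cos (h * x)) μ :=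
    Integrable.of_bound (by fun_prop) 1 (ae_of_all _ fun x => Real.abs_cos_le_one _)
  have h3 : ∫ x, f x ^ 2 ∂μ ≤ ∫ x, (2 - 2 * Real.cos (h * x)) ∂μ := by
    refine integral_mono_ae hf.integrable_sq ((integrable_const 2).sub (hcos.const_mul 2)) ?_
    filter_upwards [hμ] with x hx
    change ‖Complex.exp (t * x * Complex.I) - Complex.exp (s * x * Complex.I)‖ ^ 2 ≤ _
    rw [← Complex.ofReal_mul, ← Complex.ofReal_mul, norm_exp_ofReal_mul_I_sub_sq]
    -- The band limit enters here: `|t * x - s * x| ≤ |h * x| ≤ π`, and cosine decreases on `[0,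
    -- π]`.
    have : Real.cos (h * x) ≤ Real.cos (t * x - s * x) := by
      rw [← Real.cos_abs (h * x), ← Real.cos_abs (t * x - s * x)]
      refine Real.cos_le_cos_of_nonneg_of_le_pi (abs_nonneg _) hx ?_
      rw [← sub_mul, abs_mul, abs_mul]
      exact mul_le_mul_of_nonneg_right (hst.trans (le_abs_self h)) (abs_nonneg x)
    linarith
  have h4 : (charFun μ h).re = ∫ x, Real.cos (h * x) ∂μ := by
    rw [charFun_apply_real]
    have := integral_re (hint h)
    simp only [RCLike.re_eq_complex_re] at this
    rw [← this]
    refine integral_congr_ae (ae_of_all _ fun x => ?_)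
    simp only
    rw [← Complex.ofReal_mul, Complex.exp_ofReal_mul_I_re]
  have h5 : ∫ x, (2 - 2 * Real.cos (h * x)) ∂μ = 2 - 2 * (charFun μ h).re := by
    rw [integral_sub (integrable_const 2) (hcos.const_mul 2), integral_const_mul, h4]
    simp
  rw [← h5]
  exact (pow_le_pow_left₀ (norm_nonneg _) h1 2).trans (h2.trans h3)

/-- A pointwise limit of characteristic functions that is continuous at `0` is a characteristic
function. -/
theorem exists_charFun_eq_of_tendsto {μ : ℕ → Measure ℝ} [hp : ∀ n, IsProbabilityMeasure (μ n)]
    {f : ℝ → ℂ} (hf : ContinuousAt f 0) (h : ∀ t, Tendsto (fun n => charFun (μ n) t) atTop (𝓝 (f t))) :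
    ∃ ν : Measure ℝ, IsProbabilityMeasure ν ∧ ∀ t, charFun ν t = f t := by
  let P : ℕ → ProbabilityMeasure ℝ := fun n => ⟨μ n, hp n⟩
  have htight : IsTightMeasureSet (Set.range μ) := isTightMeasureSet_of_tendsto_charFun hf h
  have hcompact : IsCompact (closure (Set.range P)) := by
    refine isCompact_closure_of_isTightMeasureSet ?_
    convert htight
    ext ν
    constructor
    · rintro ⟨_, ⟨n, rfl⟩, rfl⟩
      exact ⟨n, rfl⟩
    · rintro ⟨n, rfl⟩
      exact ⟨P n, ⟨n, rfl⟩, rfl⟩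
  -- A limit along a nonprincipal ultrafilter suffices, since its characteristic function must agree
  -- with the given pointwise limit.
  obtain ⟨ν, -, hν⟩ := hcompact.ultrafilter_le_nhds ((hyperfilter ℕ).map P)
    (by
      rw [le_principal_iff]
      exact Filter.mem_map.mpr (Filter.univ_mem' fun n => subset_closure ⟨n, rfl⟩))
  refine ⟨ν, inferInstance, fun t => ?_⟩
  have hν' : Tendsto P (hyperfilter ℕ) (𝓝 ν) := hν
  rw [ProbabilityMeasure.tendsto_iff_forall_integral_rclike_tendsto ℂ] at hν'
  have h1 := hν' (BoundedContinuousFunction.innerProbChar t)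
  simp only [← charFun_eq_integral_innerProbChar] at h1
  exact tendsto_nhds_unique h1 ((h t).mono_left Nat.hyperfilter_le_atTop)

namespace UnitaryRep

variable {H : Type u} [NormedAddCommGroup H] [InnerProductSpace ℂ H]

/-- Measures built from ever finer samples have characteristic functions converging to the
coefficient: on lattice points by the wrap-around bound, between them by the band-limited estimate.
Continuity of the orbit then makes the limit a characteristic function. -/
theorem exists_probabilityMeasure_charFun_eq (U : UnitaryRep H) (hU : U.IsStronglyContinuous)
    {v : H} (hv : ‖v‖ = 1) :
    ∃ μ : Measure ℝ, IsProbabilityMeasure μ ∧ ∀ t, charFun μ t = ⟪v, U t v⟫_ℂ := by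
  have hcont : Continuous fun t => ⟪v, U t v⟫_ℂ := continuous_const.inner (hU v)
  have hpos : ∀ n : ℕ, (0 : ℝ) < 1 / ((n : ℝ) + 1) := fun n => Nat.one_div_pos_of_nat
  -- Mesh `1 / (n + 1)` with `(n + 1) ^ 2` samples: the mesh shrinks while the window grows, and for
  -- fixed `t` the lattice index is of order `n`, so the error `2 * m / N` tends to zero.
  choose μ hprob hband hμ using fun n : ℕ =>
    U.exists_measure_norm_charFun_sub_le hv (hpos n) ((n + 1) ^ 2)
  refine exists_charFun_eq_of_tendsto (μ := μ) hcont.continuousAt ?_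
  have hlim : Tendsto (fun n : ℕ => 1 / ((n : ℝ) + 1)) atTop (𝓝 0) :=
    tendsto_one_div_add_atTop_nhds_zero_nat
  have hnn : ∀ t : ℝ, 0 ≤ t → Tendsto (fun n => charFun (μ n) t) atTop (𝓝 ⟪v, U t v⟫_ℂ) := by
    intro t ht
    let m : ℕ → ℕ := fun n => ⌊t * (n + 1)⌋₊
    let s : ℕ → ℝ := fun n => 1 / ((n : ℝ) + 1) * m n
    have hs1 : ∀ n, |t - s n| ≤ 1 / ((n : ℝ) + 1) := by
      intro n
      have hn : (0 : ℝ) < (n : ℝ) + 1 := by positivity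
      have h1 := Nat.floor_le (by positivity : 0 ≤ t * ((n : ℝ) + 1))
      have h2 := Nat.lt_floor_add_one (t * ((n : ℝ) + 1))
      have h3 : t - s n = 1 / ((n : ℝ) + 1) * (t * (n + 1) - m n) := by
        simp only [s]; field_simp
      rw [h3, abs_mul, abs_of_pos (hpos n)]
      refine mul_le_of_le_one_right (hpos n).le (abs_le.mpr ⟨?_, ?_⟩) <;> simp only [m] <;> linarith
    have hs : Tendsto s atTop (𝓝 t) := by
      rw [tendsto_iff_norm_sub_tendsto_zero]
      refine squeeze_zero (fun _ => norm_nonneg _) (fun n => ?_) hlim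
      rw [Real.norm_eq_abs, abs_sub_comm]
      exact hs1 n
    have hm : Tendsto (fun n : ℕ => 2 * (m n : ℝ) / (((n + 1) ^ 2 : ℕ) : ℝ)) atTop (𝓝 0) := by
      have : (fun n : ℕ => 2 * (m n : ℝ) / (((n + 1) ^ 2 : ℕ) : ℝ)) =
          fun n : ℕ => 2 * s n * (1 / ((n : ℝ) + 1)) := by
        funext n
        simp only [s]
        push_cast
        field_simp
      rw [this]
      simpa using (hs.const_mul 2).mul hlim
    have hA : Tendsto (fun n => charFun (μ n) (s n) - ⟪v, U (s n) v⟫_ℂ) atTop (𝓝 0) := by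
      refine squeeze_zero_norm (fun n => ?_) hm
      exact hμ n (m n)
    -- Convergence at one mesh width, the case `m = 1`, is what makes the bound `2 - 2 * (charFun μ
    -- h).re` tend to zero.
    have hB : Tendsto (fun n => charFun (μ n) (1 / ((n : ℝ) + 1))) atTop (𝓝 1) := by
      have h1 : Tendsto (fun n => charFun (μ n) (1 / ((n : ℝ) + 1)) -
          ⟪v, U (1 / ((n : ℝ) + 1)) v⟫_ℂ) atTop (𝓝 0) := by
        have h2 : Tendsto (fun n : ℕ => 2 * (1 / ((n : ℝ) + 1) * (1 / ((n : ℝ) + 1)))) atTop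
            (𝓝 0) := by
          simpa using (hlim.mul hlim).const_mul 2
        refine squeeze_zero_norm (fun n => ?_) h2
        have h3 := hμ n 1
        rw [Nat.cast_one, mul_one, mul_one] at h3
        refine h3.trans_eq ?_
        push_cast
        field_simp
      have h2 : Tendsto (fun n : ℕ => ⟪v, U (1 / ((n : ℝ) + 1)) v⟫_ℂ) atTop (𝓝 1) := by
        have h3 := (hcont.tendsto 0).comp hlim
        rw [U.map_zero, inner_self_eq_norm_sq_to_K, hv] at h3
        simpa [Function.comp_def] using h3
      simpa using h1.add h2
    have hC : Tendsto (fun n => charFun (μ n) t - charFun (μ n) (s n)) atTop (𝓝 0) := by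
      have h1 : Tendsto (fun n => √(2 - 2 * (charFun (μ n) (1 / ((n : ℝ) + 1))).re)) atTop
          (𝓝 0) := by
        have h2 := (((Complex.continuous_re.tendsto 1).comp hB).const_mul 2).const_sub 2
        have h3 := h2.sqrt
        simpa [Function.comp_def] using h3
      refine squeeze_zero_norm (fun n => ?_) h1
      exact Real.le_sqrt_of_sq_le (norm_charFun_sub_sq_le (hband n) (hs1 n))
    have hD := (hcont.tendsto t).comp hs
    have := (hC.add hA).add hD
    simpa [Function.comp_def] using this
  intro t
  rcases le_total 0 t with ht | ht
  · exact hnn t ht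
  -- Negative times follow from Hermitian symmetry of both sides.
  · have h1 := (Complex.continuous_conj.tendsto _).comp (hnn (-t) (neg_nonneg.mpr ht))
    simp only [Function.comp_def, ← charFun_neg, neg_neg] at h1
    rwa [inner_conj_symm, ← U.inner_apply_right] at h1

/-- Bochner's theorem for the matrix coefficients of a strongly continuous unitary one-parameter
group. -/
theorem exists_measure_charFun_eq (U : UnitaryRep H) (hU : U.IsStronglyContinuous) (v : H) :
    ∃ μ : Measure ℝ, IsFiniteMeasure μ ∧ ∀ t, charFun μ t = ⟪v, U t v⟫_ℂ := by
  by_cases hv : v = 0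
  · exact ⟨0, inferInstance, fun t => by simp [hv, charFun_apply]⟩
  have hv' : ‖v‖ ≠ 0 := norm_ne_zero_iff.mpr hv
  have hw : ‖((‖v‖⁻¹ : ℝ) : ℂ) • v‖ = 1 := by
    rw [norm_smul, Complex.norm_real, norm_inv, norm_norm, inv_mul_cancel₀ hv']
  obtain ⟨μ, hμ, h⟩ := U.exists_probabilityMeasure_charFun_eq hU hw
  refine ⟨ENNReal.ofReal (‖v‖ ^ 2) • μ, μ.smul_finite ENNReal.ofReal_ne_top, fun t => ?_⟩
  rw [charFun_apply_real, integral_smul_measure, ← charFun_apply_real, h,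
    ENNReal.toReal_ofReal (by positivity), map_smul, inner_smul_left, inner_smul_right,
    Complex.conj_ofReal, Complex.real_smul]
  have : (‖v‖ : ℂ) ≠ 0 := by exact_mod_cast hv'
  push_cast
  field_simp

end UnitaryRep

/-! ### Fourier uniqueness for complex combinations of finite measures. -/

/-- The pairs `(t ↦ ∫ exp (i t x) dν(x), ν B)`, for `ν` a complex linear combination of finite
measures. -/
def charFunGraph (B : Set ℝ) : Submodule ℂ ((ℝ → ℂ) × ℂ) :=
  Submodule.span ℂ (Set.range fun ν : {ν : Measure ℝ // IsFiniteMeasure ν} =>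
    ((charFun ν.1, (ν.1.real B : ℂ)) : (ℝ → ℂ) × ℂ))

theorem charFun_mem_charFunGraph (B : Set ℝ) (ν : Measure ℝ) [hν : IsFiniteMeasure ν] :
    ((charFun ν, (ν.real B : ℂ)) : (ℝ → ℂ) × ℂ) ∈ charFunGraph B :=
  Submodule.subset_span ⟨⟨ν, hν⟩, rfl⟩

/-- Moving the negative coefficients to the other side leaves two finite positive measures with
equal characteristic functions; these coincide. -/
theorem sum_mul_measureReal_eq_zero {ι : Type*} (s : Finset ι) (ν : ι → Measure ℝ)
    [∀ i, IsFiniteMeasure (ν i)] (r : ι → ℝ)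
    (h : ∀ t, ∑ i ∈ s, (r i : ℂ) * charFun (ν i) t = 0) (B : Set ℝ) :
    ∑ i ∈ s, r i * (ν i).real B = 0 := by
  let M : (ι → ℝ) → Measure ℝ := fun r => ∑ i ∈ s, ENNReal.ofReal (r i) • ν i
  have hfin : ∀ r, IsFiniteMeasure (M r) := fun r => by
    refine ⟨?_⟩
    simp only [M, Measure.finsetSum_apply, Measure.smul_apply, smul_eq_mul]
    exact ENNReal.sum_lt_top.mpr fun i _ =>
      ENNReal.mul_lt_top ENNReal.ofReal_lt_top (measure_lt_top _ _)
  have hchar : ∀ r t, charFun (M r) t = ∑ i ∈ s, ((max (r i) 0 : ℝ) : ℂ) * charFun (ν i) t := by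
    intro r t
    have hi : ∀ i, Integrable (fun x : ℝ => Complex.exp (t * x * Complex.I)) (ν i) := fun i =>
      Integrable.of_bound (by fun_prop) 1 (ae_of_all _ fun x => by
        rw [← Complex.ofReal_mul, Complex.norm_exp_ofReal_mul_I])
    rw [charFun_apply_real, integral_finsetSum_measure fun i _ =>
      (hi i).smul_measure ENNReal.ofReal_ne_top]
    refine Finset.sum_congr rfl fun i _ => ?_
    rw [integral_smul_measure, ENNReal.toReal_ofReal', charFun_apply_real, Complex.real_smul]
  have hreal : ∀ r, (M r).real B = ∑ i ∈ s, max (r i) 0 * (ν i).real B := by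
    intro r
    simp only [measureReal_def, M, Measure.finsetSum_apply, Measure.smul_apply, smul_eq_mul]
    rw [ENNReal.toReal_sum fun i _ => ENNReal.mul_ne_top ENNReal.ofReal_ne_top (measure_ne_top _ _)]
    simp only [ENNReal.toReal_mul, ENNReal.toReal_ofReal']
  have hsplit : ∀ a : ℝ, max a 0 - max (-a) 0 = a := fun a => by
    rcases le_total a 0 with ha | ha
    · rw [max_eq_right ha, max_eq_left (neg_nonneg.mpr ha)]; ring
    · rw [max_eq_left ha, max_eq_right (neg_nonpos.mpr ha)]; ring
  have heq : M r = M (fun i => -r i) := by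
    refine Measure.ext_of_charFun (funext fun t => sub_eq_zero.mp ?_)
    rw [hchar, hchar, ← Finset.sum_sub_distrib, ← h t]
    refine Finset.sum_congr rfl fun i _ => ?_
    rw [← sub_mul, ← Complex.ofReal_sub, hsplit]
  have h2 := sub_eq_zero.mpr (congrArg (fun m : Measure ℝ => m.real B) heq)
  rw [hreal, hreal, ← Finset.sum_sub_distrib] at h2
  rw [← h2]
  refine Finset.sum_congr rfl fun i _ => ?_
  rw [← sub_mul, hsplit]

/-- A complex combination of finite measures is determined by its Fourier transform. -/
theorem charFunGraph_unique {B : Set ℝ} {f : ℝ → ℂ} {z w : ℂ} (hz : (f, z) ∈ charFunGraph B)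
    (hw : (f, w) ∈ charFunGraph B) : z = w := by
  have h : ((0, z - w) : (ℝ → ℂ) × ℂ) ∈ charFunGraph B := by
    have := (charFunGraph B).sub_mem hz hw
    rwa [Prod.mk_sub_mk, sub_self] at this
  obtain ⟨c, hc⟩ := (Finsupp.mem_span_range_iff_exists_finsupp).mp h
  rw [Finsupp.sum, Prod.ext_iff] at hc
  have h1 : ∀ t, ∑ i ∈ c.support, c i * charFun i.1 t = 0 := fun t => by
    have := congrFun hc.1 t
    simpa [Prod.fst_sum] using this
  have h2 : ∑ i ∈ c.support, c i * (i.1.real B : ℂ) = z - w := by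
    have := hc.2
    simpa [Prod.snd_sum] using this
  -- Conjugating the relation at `-t` shows that the conjugate coefficients satisfy it too, hence so
  -- do the real and imaginary parts separately.
  have h1' : ∀ t, ∑ i ∈ c.support, conj (c i) * charFun i.1 t = 0 := fun t => by
    have := congrArg conj (h1 (-t))
    simpa only [map_sum, map_mul, charFun_neg, Complex.conj_conj, map_zero] using this
  have hfin : ∀ i : {ν : Measure ℝ // IsFiniteMeasure ν}, IsFiniteMeasure i.1 := fun i => i.2
  have hre := sum_mul_measureReal_eq_zero c.support (fun i => i.1) (fun i => (c i).re) (fun t => by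
    have : ∀ i, ((c i).re : ℂ) = (1 / 2) * (c i + conj (c i)) := fun i => by
      rw [Complex.add_conj]; push_cast; ring
    simp only [this, mul_assoc, ← Finset.mul_sum, add_mul, Finset.sum_add_distrib, h1, h1']
    simp) B
  have him := sum_mul_measureReal_eq_zero c.support (fun i => i.1) (fun i => (c i).im) (fun t => by
    have : ∀ i, ((c i).im : ℂ) = (-Complex.I / 2) * (c i - conj (c i)) := fun i => by
      rw [Complex.sub_conj]
      push_cast
      linear_combination ((c i).im : ℂ) * Complex.I_sq
    simp only [this, mul_assoc, ← Finset.mul_sum, sub_mul, Finset.sum_sub_distrib, h1, h1']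
    simp) B
  refine sub_eq_zero.mp ?_
  rw [← h2]
  apply Complex.ext
  · simpa using hre
  · simpa using him

theorem integrable_exp_mul (t : ℝ) {ν : Measure ℝ} {g : ℝ → ℂ} (hg : Integrable g ν) :
    Integrable (fun x : ℝ => Complex.exp (t * x * Complex.I) * g x) ν :=
  hg.bdd_mul (c := 1) (by fun_prop) (ae_of_all _ fun x => by
    rw [← Complex.ofReal_mul, Complex.norm_exp_ofReal_mul_I])

/-- A nonnegative integrable function is the density of a finite measure, which is itself a
generator of the span. -/
theorem integral_pos_mem_charFunGraph {B : Set ℝ} (hB : MeasurableSet B) {ν : Measure ℝ}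
    [IsFiniteMeasure ν] {g : ℝ → ℝ} (hg : Integrable g ν) :
    ((fun t : ℝ => ∫ x, Complex.exp (t * x * Complex.I) * ((max (g x) 0 : ℝ) : ℂ) ∂ν,
      ∫ x in B, ((max (g x) 0 : ℝ) : ℂ) ∂ν) : (ℝ → ℂ) × ℂ) ∈ charFunGraph B := by
  have hmeas : AEMeasurable (fun x => ENNReal.ofReal (g x)) ν := hg.aemeasurable.ennreal_ofReal
  have hfin : IsFiniteMeasure (ν.withDensity fun x => ENNReal.ofReal (g x)) :=
    isFiniteMeasure_withDensity_ofReal hg.2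
  convert charFun_mem_charFunGraph B (ν.withDensity fun x => ENNReal.ofReal (g x)) using 2
  · funext t
    rw [charFun_apply_real, integral_withDensity_eq_integral_toReal_smul₀ hmeas
      (ae_of_all _ fun x => ENNReal.ofReal_lt_top)]
    refine integral_congr_ae (ae_of_all _ fun x => ?_)
    simp only
    rw [ENNReal.toReal_ofReal', Complex.real_smul, mul_comm]
  · rw [measureReal_def, withDensity_apply _ hB, integral_complex_ofReal]
    congr 1
    rw [integral_eq_lintegral_of_nonneg_ae (f := fun x => max (g x) 0) (ae_of_all _ fun x => le_max_right _ _)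
      hg.pos_part.aestronglyMeasurable.restrict]
    congr 1
    refine lintegral_congr fun x => ?_
    rw [ENNReal.ofReal_max, ENNReal.ofReal_zero, max_eq_left (zero_le)]

/-- Complex densities split into four nonnegative ones. This admits the densities `exp (i s x)`,
needed to describe the coefficients of `U s x`. -/
theorem integral_mem_charFunGraph {B : Set ℝ} (hB : MeasurableSet B) {ν : Measure ℝ}
    [IsFiniteMeasure ν] {g : ℝ → ℂ} (hg : Integrable g ν) :
    ((fun t : ℝ => ∫ x, Complex.exp (t * x * Complex.I) * g x ∂ν, ∫ x in B, g x ∂ν) :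
      (ℝ → ℂ) × ℂ) ∈ charFunGraph B := by
  let p : (ℝ → ℝ) → ((ℝ → ℂ) × ℂ) := fun g =>
    (fun t : ℝ => ∫ x, Complex.exp (t * x * Complex.I) * ((max (g x) 0 : ℝ) : ℂ) ∂ν,
      ∫ x in B, ((max (g x) 0 : ℝ) : ℂ) ∂ν)
  have hre := hg.re
  have him := hg.im
  simp only [RCLike.re_eq_complex_re, RCLike.im_eq_complex_im] at hre him
  have hmem : p (fun x => (g x).re) - p (fun x => -(g x).re) +
      Complex.I • (p (fun x => (g x).im) - p (fun x => -(g x).im)) ∈ charFunGraph B :=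
    (charFunGraph B).add_mem ((charFunGraph B).sub_mem (integral_pos_mem_charFunGraph hB hre)
      (integral_pos_mem_charFunGraph hB hre.neg)) ((charFunGraph B).smul_mem _
      ((charFunGraph B).sub_mem (integral_pos_mem_charFunGraph hB him)
        (integral_pos_mem_charFunGraph hB him.neg)))
  have hsplit : ∀ a : ℝ, max a 0 - max (-a) 0 = a := fun a => by
    rcases le_total a 0 with ha | ha
    · rw [max_eq_right ha, max_eq_left (neg_nonneg.mpr ha)]; ring
    · rw [max_eq_left ha, max_eq_right (neg_nonpos.mpr ha)]; ring
  have hdec : ∀ x, g x = (((max (g x).re 0 : ℝ) : ℂ) - ((max (-(g x).re) 0 : ℝ) : ℂ)) +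
      Complex.I * (((max (g x).im 0 : ℝ) : ℂ) - ((max (-(g x).im) 0 : ℝ) : ℂ)) := fun x => by
    rw [← Complex.ofReal_sub, ← Complex.ofReal_sub, hsplit, hsplit, mul_comm, Complex.re_add_im]
  have i1 : Integrable (fun x => ((max (g x).re 0 : ℝ) : ℂ)) ν := hre.pos_part.ofReal
  have i2 : Integrable (fun x => ((max (-(g x).re) 0 : ℝ) : ℂ)) ν := hre.neg_part.ofReal
  have i3 : Integrable (fun x => ((max (g x).im 0 : ℝ) : ℂ)) ν := him.pos_part.ofReal
  have i4 : Integrable (fun x => ((max (-(g x).im) 0 : ℝ) : ℂ)) ν := him.neg_part.ofReal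
  have hcomb : ∀ {m : Measure ℝ} {a b c d : ℝ → ℂ}, Integrable a m → Integrable b m →
      Integrable c m → Integrable d m → ∫ x, ((a x - b x) + Complex.I * (c x - d x)) ∂m =
        (∫ x, a x ∂m - ∫ x, b x ∂m) + Complex.I * (∫ x, c x ∂m - ∫ x, d x ∂m) := by
    intro m a b c d ha hb hc hd
    rw [integral_add (f := fun x => a x - b x) (g := fun x => Complex.I * (c x - d x))
      (ha.sub hb) ((hc.sub hd).const_mul _), integral_const_mul, integral_sub ha hb, integral_sub hc hd]
  convert hmem using 1
  refine Prod.ext (funext fun t => ?_) ?_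
  · refine Eq.trans ?_ (hcomb (integrable_exp_mul t i1) (integrable_exp_mul t i2)
      (integrable_exp_mul t i3) (integrable_exp_mul t i4))
    refine integral_congr_ae (ae_of_all _ fun x => ?_)
    simp only
    conv_lhs => rw [hdec x]
    ring
  · exact (integral_congr_ae (ae_of_all _ hdec)).trans
      (hcomb i1.restrict i2.restrict i3.restrict i4.restrict)

/-! ### Construction of the spectral measure. -/

namespace UnitaryRep

variable {H : Type u} [NormedAddCommGroup H] [InnerProductSpace ℂ H]
  {U : UnitaryRep H}

/-- The measure whose Fourier transform is `t ↦ ⟪v, U t v⟫`. -/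
def measureAt (hU : U.IsStronglyContinuous) (v : H) : Measure ℝ :=
  Classical.choose (U.exists_measure_charFun_eq hU v)

instance isFiniteMeasure_measureAt (hU : U.IsStronglyContinuous) (v : H) :
    IsFiniteMeasure (measureAt hU v) :=
  (Classical.choose_spec (U.exists_measure_charFun_eq hU v)).1

theorem charFun_measureAt (hU : U.IsStronglyContinuous) (v : H) (t : ℝ) :
    charFun (measureAt hU v) t = ⟪v, U t v⟫_ℂ :=
  (Classical.choose_spec (U.exists_measure_charFun_eq hU v)).2 t

theorem measureReal_univ_measureAt (hU : U.IsStronglyContinuous) (v : H) :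
    (measureAt hU v).real Set.univ = ‖v‖ ^ 2 := by
  have h := charFun_measureAt hU v 0
  rw [charFun_zero, U.map_zero, inner_self_eq_norm_sq_to_K] at h
  refine Complex.ofReal_injective (h.trans ?_)
  push_cast
  rfl

/-- The polarization of the quadratic form `v ↦ measureAt hU v B`. -/
def polarForm (hU : U.IsStronglyContinuous) (B : Set ℝ) (x y : H) : ℂ :=
  (1 / 4) * ∑ k : Fin 4, conj (Complex.I ^ (k : ℕ)) *
    ((measureAt hU (x + Complex.I ^ (k : ℕ) • y)).real B : ℂ)

theorem polarForm_mem_charFunGraph (hU : U.IsStronglyContinuous) (B : Set ℝ) (x y : H) :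
    ((fun t => ⟪x, U t y⟫_ℂ, polarForm hU B x y) : (ℝ → ℂ) × ℂ) ∈ charFunGraph B := by
  have h : (1 / 4 : ℂ) • ∑ k : Fin 4, conj (Complex.I ^ (k : ℕ)) •
      ((charFun (measureAt hU (x + Complex.I ^ (k : ℕ) • y)),
        ((measureAt hU (x + Complex.I ^ (k : ℕ) • y)).real B : ℂ)) : (ℝ → ℂ) × ℂ) ∈
      charFunGraph B :=
    (charFunGraph B).smul_mem _ ((charFunGraph B).sum_mem fun k _ =>
      (charFunGraph B).smul_mem _ (charFun_mem_charFunGraph B _))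
  convert h using 1
  refine Prod.ext (funext fun t => ?_) ?_
  · simp only [Fin.sum_univ_four, Prod.smul_fst, Prod.fst_add, Pi.smul_apply, Pi.add_apply,
      smul_eq_mul, charFun_measureAt, _root_.map_add, map_smul, inner_add_left,
      inner_add_right, inner_smul_left, inner_smul_right, map_pow, Complex.conj_I]
    have h2 := Complex.I_sq
    have h3 : Complex.I ^ 3 = -Complex.I := Complex.I_pow_three
    simp only [Fin.coe_ofNat_eq_mod, Nat.zero_mod, Nat.one_mod, Nat.reduceMod, pow_zero, pow_one,
      neg_sq, h2, h3, Odd.neg_pow (by decide : Odd 3)]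
    ring_nf
    simp only [h2]
    ring
  · simp only [Prod.smul_snd, Prod.snd_sum, smul_eq_mul, polarForm]

/-- The working principle of the construction: an identity for the form on `B` need only be checked
on matrix coefficients, because these are Fourier transforms and determine the value. -/
theorem polarForm_eq (hU : U.IsStronglyContinuous) {B : Set ℝ} {x y : H} {f : ℝ → ℂ} {z : ℂ}
    (hz : (f, z) ∈ charFunGraph B) (hf : ∀ t, ⟪x, U t y⟫_ℂ = f t) : polarForm hU B x y = z := by
  obtain rfl : (fun t => ⟪x, U t y⟫_ℂ) = f := funext hf
  exact charFunGraph_unique (polarForm_mem_charFunGraph hU B x y) hz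

theorem polarForm_self (hU : U.IsStronglyContinuous) (B : Set ℝ) (x : H) :
    polarForm hU B x x = ((measureAt hU x).real B : ℂ) :=
  polarForm_eq hU (charFun_mem_charFunGraph B _) fun t => (charFun_measureAt hU x t).symm

theorem polarForm_add_left (hU : U.IsStronglyContinuous) (B : Set ℝ) (x x' y : H) :
    polarForm hU B (x + x') y = polarForm hU B x y + polarForm hU B x' y :=
  polarForm_eq hU ((charFunGraph B).add_mem (polarForm_mem_charFunGraph hU B x y)
    (polarForm_mem_charFunGraph hU B x' y)) fun _ => inner_add_left _ _ _

theorem polarForm_add_right (hU : U.IsStronglyContinuous) (B : Set ℝ) (x y y' : H) :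
    polarForm hU B x (y + y') = polarForm hU B x y + polarForm hU B x y' :=
  polarForm_eq hU ((charFunGraph B).add_mem (polarForm_mem_charFunGraph hU B x y)
    (polarForm_mem_charFunGraph hU B x y')) fun t => by
      simp only [_root_.map_add, inner_add_right, Pi.add_apply]

theorem polarForm_smul_left (hU : U.IsStronglyContinuous) (B : Set ℝ) (c : ℂ) (x y : H) :
    polarForm hU B (c • x) y = conj c * polarForm hU B x y :=
  polarForm_eq hU ((charFunGraph B).smul_mem (conj c) (polarForm_mem_charFunGraph hU B x y))
    fun _ => inner_smul_left _ _ _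

theorem polarForm_smul_right (hU : U.IsStronglyContinuous) (B : Set ℝ) (c : ℂ) (x y : H) :
    polarForm hU B x (c • y) = c * polarForm hU B x y :=
  polarForm_eq hU ((charFunGraph B).smul_mem c (polarForm_mem_charFunGraph hU B x y))
    fun t => by simp only [map_smul, inner_smul_right, Pi.smul_apply, smul_eq_mul]

/-- For unit vectors each of the four polarization terms is at most `‖x + i ^ k • y‖ ^ 2 ≤ 4`, which
gives the crude constant `4`; sesquilinearity rescales it. -/
theorem norm_polarForm_le (hU : U.IsStronglyContinuous) (B : Set ℝ) (x y : H) :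
    ‖polarForm hU B x y‖ ≤ 4 * ‖x‖ * ‖y‖ := by
  have hunit : ∀ x y : H, ‖x‖ = 1 → ‖y‖ = 1 → ‖polarForm hU B x y‖ ≤ 4 := by
    intro x y hx hy
    have hk : ∀ k : Fin 4, ‖conj (Complex.I ^ (k : ℕ)) *
        ((measureAt hU (x + Complex.I ^ (k : ℕ) • y)).real B : ℂ)‖ ≤ 4 := by
      intro k
      rw [norm_mul, RCLike.norm_conj, norm_pow, Complex.norm_I, one_pow, one_mul,
        Complex.norm_real, Real.norm_of_nonneg measureReal_nonneg]
      refine (measureReal_mono (Set.subset_univ B)).trans ?_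
      rw [measureReal_univ_measureAt]
      have h1 := norm_add_le x (Complex.I ^ (k : ℕ) • y)
      rw [norm_smul, norm_pow, Complex.norm_I, one_pow, one_mul, hx, hy] at h1
      nlinarith [norm_nonneg (x + Complex.I ^ (k : ℕ) • y)]
    rw [polarForm, norm_mul]
    have h2 := (norm_sum_le_of_le Finset.univ fun k _ => hk k)
    rw [Finset.sum_const, Finset.card_univ, Fintype.card_fin] at h2
    norm_num at h2 ⊢
    linarith
  by_cases hx : x = 0
  · have := polarForm_smul_left hU B 0 x y
    rw [zero_smul, _root_.map_zero, zero_mul] at this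
    rw [hx, this]; simp
  by_cases hy : y = 0
  · have := polarForm_smul_right hU B 0 x y
    rw [zero_smul, zero_mul] at this
    rw [hy, this]; simp
  have hx' : ‖x‖ ≠ 0 := norm_ne_zero_iff.mpr hx
  have hy' : ‖y‖ ≠ 0 := norm_ne_zero_iff.mpr hy
  have hn : ∀ z : H, ‖z‖ ≠ 0 → ‖((‖z‖⁻¹ : ℝ) : ℂ) • z‖ = 1 := fun z hz => by
    rw [norm_smul, Complex.norm_real, norm_inv, norm_norm, inv_mul_cancel₀ hz]
  have h := hunit _ _ (hn x hx') (hn y hy')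
  rw [polarForm_smul_left, polarForm_smul_right, norm_mul, norm_mul, RCLike.norm_conj,
    Complex.norm_real, Complex.norm_real, norm_inv, norm_inv, norm_norm, norm_norm] at h
  have hxp := (norm_nonneg x).lt_of_ne' hx'
  have hyp := (norm_nonneg y).lt_of_ne' hy'
  calc ‖polarForm hU B x y‖ = ‖x‖ * ‖y‖ * (‖x‖⁻¹ * (‖y‖⁻¹ * ‖polarForm hU B x y‖)) := by
        field_simp
    _ ≤ ‖x‖ * ‖y‖ * 4 := mul_le_mul_of_nonneg_left h (by positivity)
    _ = 4 * ‖x‖ * ‖y‖ := by ring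

variable [CompleteSpace H]

/-- The spectral projection of a Borel set. -/
def spectralProj (hU : U.IsStronglyContinuous) (B : Set ℝ) : H →L[ℂ] H :=
  -- Riesz representation places the operator in the left slot of the inner product; the adjoint
  -- moves it to the right.
  ContinuousLinearMap.adjoint (InnerProductSpace.continuousLinearMapOfBilin
    (LinearMap.mkContinuous₂ (LinearMap.mk₂'ₛₗ (starRingEnd ℂ) (RingHom.id ℂ) (polarForm hU B)
      (polarForm_add_left hU B) (polarForm_smul_left hU B) (polarForm_add_right hU B)
      (polarForm_smul_right hU B)) 4 (norm_polarForm_le hU B)))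

theorem inner_spectralProj (hU : U.IsStronglyContinuous) (B : Set ℝ) (x y : H) :
    ⟪x, spectralProj hU B y⟫_ℂ = polarForm hU B x y := by
  rw [spectralProj, ContinuousLinearMap.adjoint_inner_right,
    InnerProductSpace.continuousLinearMapOfBilin_apply]
  rfl

theorem inner_spectralProj_self (hU : U.IsStronglyContinuous) (B : Set ℝ) (x : H) :
    ⟪x, spectralProj hU B x⟫_ℂ = ((measureAt hU x).real B : ℂ) := by
  rw [inner_spectralProj, polarForm_self]

end UnitaryRep

theorem ContinuousLinearMap.ext_of_inner_self {H : Type*} [NormedAddCommGroup H]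
    [InnerProductSpace ℂ H] {S T : H →L[ℂ] H} (h : ∀ x, ⟪x, S x⟫_ℂ = ⟪x, T x⟫_ℂ) : S = T := by
  refine ContinuousLinearMap.coe_injective ((ext_inner_map _ _).mp fun x => ?_)
  have := congrArg conj (h x)
  rwa [inner_conj_symm, inner_conj_symm] at this

namespace UnitaryRep

variable {H : Type u} [NormedAddCommGroup H] [InnerProductSpace ℂ H] [CompleteSpace H]
  {U : UnitaryRep H}

theorem isSelfAdjoint_spectralProj (hU : U.IsStronglyContinuous) (B : Set ℝ) :
    IsSelfAdjoint (spectralProj hU B) := by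
  refine ContinuousLinearMap.ext_of_inner_self fun x => ?_
  change ⟪x, ContinuousLinearMap.adjoint (spectralProj hU B) x⟫_ℂ = _
  rw [ContinuousLinearMap.adjoint_inner_right, ← inner_conj_symm, inner_spectralProj_self,
    Complex.conj_ofReal]

/-- The coefficient `t ↦ ⟪x, U t (U s x)⟫` is the Fourier transform of `exp (i s λ) dμ_x(λ)`, and
evaluating that complex measure on `B` integrates the exponential over `B`. -/
theorem inner_spectralProj_apply (hU : U.IsStronglyContinuous) {B : Set ℝ} (hB : MeasurableSet B)
    (x : H) (s : ℝ) :
    ⟪x, spectralProj hU B (U s x)⟫_ℂ = charFun ((measureAt hU x).restrict B) s := by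
  have hint : Integrable (fun x : ℝ => Complex.exp (s * x * Complex.I)) (measureAt hU x) :=
    Integrable.of_bound (by fun_prop) 1 (ae_of_all _ fun x => by
      rw [← Complex.ofReal_mul, Complex.norm_exp_ofReal_mul_I])
  rw [inner_spectralProj, charFun_apply_real]
  refine polarForm_eq hU (integral_mem_charFunGraph hB hint) fun t => ?_
  rw [← U.map_add, ← charFun_measureAt hU, charFun_apply_real]
  refine integral_congr_ae (ae_of_all _ fun x => ?_)
  simp only
  rw [← Complex.exp_add]
  push_cast
  ring_nf

/-- The coefficient of the pair `x`, `E(B) x` is the Fourier transform of `μ_x` restricted to `B`;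
its value on `A` is `μ_x (A ∩ B)`. -/
theorem spectralProj_inter (hU : U.IsStronglyContinuous) {A B : Set ℝ} (hA : MeasurableSet A)
    (hB : MeasurableSet B) : spectralProj hU (A ∩ B) = spectralProj hU A * spectralProj hU B := by
  refine ContinuousLinearMap.ext_of_inner_self fun x => ?_
  change _ = ⟪x, spectralProj hU A (spectralProj hU B x)⟫_ℂ
  rw [inner_spectralProj_self, inner_spectralProj]
  refine (polarForm_eq hU (charFun_mem_charFunGraph A ((measureAt hU x).restrict B))
    fun t => ?_).trans ?_ |>.symm
  · rw [U.inner_apply_right, ← ContinuousLinearMap.adjoint_inner_left,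
      (isSelfAdjoint_spectralProj hU B).adjoint_eq, ← inner_conj_symm, inner_spectralProj_apply hU hB,
      charFun_neg, Complex.conj_conj]
  · rw [measureReal_restrict_apply hA]


theorem exists_isSpectralMeasureOf (hU : U.IsStronglyContinuous) :
    ∃ E : SpectralMeasure H, E.IsSpectralMeasureOf U := by
  classical
  have hdiff : ∀ A B : Set ℝ, MeasurableSet B → B ⊆ A →
      spectralProj hU (A \ B) = spectralProj hU A - spectralProj hU B := fun A B hB hBA => by
    refine ContinuousLinearMap.ext_of_inner_self fun x => ?_
    rw [sub_apply, inner_sub_right, inner_spectralProj_self,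
      inner_spectralProj_self, inner_spectralProj_self, measureReal_sdiff hBA hB]
    push_cast
    rfl
  have hstar : ∀ B : Set ℝ, MeasurableSet B → IsStarProjection (spectralProj hU B) := fun B hB =>
    ⟨by
      have := spectralProj_inter hU hB hB
      rw [Set.inter_self] at this
      exact this.symm, isSelfAdjoint_spectralProj hU B⟩
  have hnorm : ∀ B : Set ℝ, MeasurableSet B → ∀ v,
      ‖spectralProj hU B v‖ ^ 2 = (measureAt hU v).real B := fun B hB v => by
    refine Complex.ofReal_injective ?_
    rw [← inner_spectralProj_self]
    have h1 : spectralProj hU B (spectralProj hU B v) = spectralProj hU B v :=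
      congrArg (fun T : H →L[ℂ] H => T v) (hstar B hB).isIdempotentElem
    rw [← h1, ← ContinuousLinearMap.adjoint_inner_left,
      (isSelfAdjoint_spectralProj hU B).adjoint_eq, h1, inner_self_eq_norm_sq_to_K]
    push_cast
    rfl
  let E : SpectralMeasure H :=
    { proj := fun B => if MeasurableSet B then spectralProj hU B else 0
      not_measurable := fun B hB => if_neg hB
      isStarProjection := fun B hB => by
        rw [if_pos hB]
        exact hstar B hB
      empty := by
        rw [if_pos MeasurableSet.empty]
        refine ContinuousLinearMap.ext_of_inner_self fun x => ?_
        rw [inner_spectralProj_self]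
        simp
      univ := by
        rw [if_pos MeasurableSet.univ]
        refine ContinuousLinearMap.ext_of_inner_self fun x => ?_
        rw [inner_spectralProj_self, measureReal_univ_measureAt, one_apply_eq_self,
          inner_self_eq_norm_sq_to_K]
        push_cast
        rfl
      inter := fun A B hA hB => by
        rw [if_pos hA, if_pos hB, if_pos (hA.inter hB), spectralProj_inter hU hA hB]
      hasSum_iUnion := fun f hf hd v => by
        rw [if_pos (MeasurableSet.iUnion hf)]
        simp only [if_pos (hf _)]
        have hsum : ∀ F : Finset ℕ,
            ∑ n ∈ F, spectralProj hU (f n) = spectralProj hU (⋃ n ∈ F, f n) := fun F => by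
          refine ContinuousLinearMap.ext_of_inner_self fun x => ?_
          rw [sum_apply, inner_sum, inner_spectralProj_self,
            measureReal_biUnion_finset (fun i _ j _ hij => hd hij) fun i _ => hf i]
          simp only [inner_spectralProj_self]
          push_cast
          rfl
        -- The squared error is exactly the missing scalar mass, so countable additivity of
        -- `measureAt hU v` upgrades to strong convergence.
        have hsub : ∀ F : Finset ℕ, ‖∑ n ∈ F, spectralProj hU (f n) v -
            spectralProj hU (⋃ n, f n) v‖ ^ 2 =
              (measureAt hU v).real (⋃ n, f n) - ∑ n ∈ F, (measureAt hU v).real (f n) := by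
          intro F
          have hm : MeasurableSet (⋃ n ∈ F, f n) := F.measurableSet_biUnion fun n _ => hf n
          have hle : (⋃ n ∈ F, f n) ⊆ ⋃ n, f n := Set.iUnion₂_subset_iUnion _ _
          rw [← sum_apply, hsum, norm_sub_rev, ← sub_apply,
            ← hdiff _ _ hm hle, hnorm _ ((MeasurableSet.iUnion hf).diff hm),
            measureReal_sdiff hle hm,
            measureReal_biUnion_finset (fun i _ j _ hij => hd hij) fun i _ => hf i]
        have hmeas : HasSum (fun n => (measureAt hU v).real (f n))
            ((measureAt hU v).real (⋃ n, f n)) := by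
          rw [measureReal_def, measure_iUnion hd hf,
            ENNReal.tsum_toReal_eq fun n => measure_ne_top (measureAt hU v) _]
          exact ENNReal.hasSum_toReal (by
            rw [← measure_iUnion hd hf]
            exact measure_ne_top (measureAt hU v) _)
        have h0 := Tendsto.const_sub ((measureAt hU v).real (⋃ n, f n)) hmeas
        rw [sub_self] at h0
        simp only [← hsub] at h0
        have h1 := h0.sqrt
        simp only [Real.sqrt_zero, Real.sqrt_sq (norm_nonneg _)] at h1
        exact tendsto_iff_norm_sub_tendsto_zero.mpr h1 }
  refine ⟨E, fun t v => ?_⟩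
  have hE : E.scalarMeasure v = measureAt hU v := by
    refine Measure.ext fun B hB => ?_
    rw [E.scalarMeasure_apply v hB]
    change ENNReal.ofReal (⟪v, (if MeasurableSet B then spectralProj hU B else 0) v⟫_ℂ).re = _
    rw [if_pos hB, inner_spectralProj_self, Complex.ofReal_re, ofReal_measureReal]
  rw [hE, ← charFun_apply_real, charFun_measureAt]

end UnitaryRep

/-! ### Uniqueness of the spectral measure, and operators that preserve or reflect it. -/

namespace SpectralMeasure

variable {H : Type u} [NormedAddCommGroup H] [InnerProductSpace ℂ H] [CompleteSpace H]

theorem inner_proj_self_eq_of_scalarMeasure_eq {E F : SpectralMeasure H} {v w : H} {A B : Set ℝ}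
    (hA : MeasurableSet A) (hB : MeasurableSet B)
    (h : E.scalarMeasure v A = F.scalarMeasure w B) : ⟪v, E.proj A v⟫_ℂ = ⟪w, F.proj B w⟫_ℂ := by
  rw [E.scalarMeasure_apply v hA, F.scalarMeasure_apply w hB] at h
  rw [E.inner_proj hA, F.inner_proj hB] at h ⊢
  rw [Complex.ofReal_re, Complex.ofReal_re,
    ENNReal.ofReal_eq_ofReal_iff (by positivity) (by positivity)] at h
  rw [h]

theorem IsSpectralMeasureOf.charFun_eq {E : SpectralMeasure H} {U : UnitaryRep H}
    (hE : E.IsSpectralMeasureOf U) (v : H) (t : ℝ) :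
    charFun (E.scalarMeasure v) t = ⟪v, U t v⟫_ℂ := by
  rw [charFun_apply_real, hE]

/-- Characteristic functions fix the scalar measures, and these are the quadratic forms of the
projections; the zero convention settles nonmeasurable sets. -/
theorem IsSpectralMeasureOf.unique {E F : SpectralMeasure H} {U : UnitaryRep H}
    (hE : E.IsSpectralMeasureOf U) (hF : F.IsSpectralMeasureOf U) : E = F := by
  have h : E.proj = F.proj := by
    funext B
    by_cases hB : MeasurableSet B
    · refine ContinuousLinearMap.ext_of_inner_self fun v => ?_
      refine inner_proj_self_eq_of_scalarMeasure_eq hB hB ?_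
      rw [Measure.ext_of_charFun (funext fun t => (hE.charFun_eq v t).trans (hF.charFun_eq v t).symm)]
    · rw [E.not_measurable B hB, F.not_measurable B hB]
  cases E
  cases F
  cases h
  rfl

end SpectralMeasure

/-- Norms determine real parts of inner products; replacing `w` by `i • w` then flips the imaginary
part, by antilinearity. -/
theorem inner_map_map_of_conj {H K : Type*} [NormedAddCommGroup H] [InnerProductSpace ℂ H]
    [NormedAddCommGroup K] [InnerProductSpace ℂ K] (C : H ≃ₗᵢ⋆[ℂ] K) (v w : H) :
    ⟪C v, C w⟫_ℂ = ⟪w, v⟫_ℂ := by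
  have hre : ∀ v w : H, (⟪C v, C w⟫_ℂ).re = (⟪v, w⟫_ℂ).re := fun v w => by
    have h1 := norm_add_sq (𝕜 := ℂ) (C v) (C w)
    have h2 := norm_add_sq (𝕜 := ℂ) v w
    rw [← map_add, C.norm_map, C.norm_map, C.norm_map, h2] at h1
    simp only [RCLike.re_eq_complex_re] at h1
    linarith
  rw [← inner_conj_symm w v]
  apply Complex.ext
  · rw [hre, Complex.conj_re]
  · have h := hre v (Complex.I • w)
    rw [C.map_smulₛₗ, inner_smul_right, inner_smul_right, Complex.conj_I] at h
    simp only [Complex.mul_re, Complex.neg_re, Complex.neg_im, Complex.I_re, Complex.I_im] at h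
    rw [Complex.conj_im]
    linarith

namespace SpectralMeasure

variable {H : Type u} [NormedAddCommGroup H] [InnerProductSpace ℂ H] [CompleteSpace H]
  {E : SpectralMeasure H} {U : UnitaryRep H}

theorem proj_proj (E : SpectralMeasure H) {A B : Set ℝ} (hA : MeasurableSet A)
    (hB : MeasurableSet B) (v : H) : E.proj A (E.proj B v) = E.proj (A ∩ B) v := by
  rw [E.inter A B hA hB]
  rfl

theorem proj_proj_self (E : SpectralMeasure H) {B : Set ℝ} (hB : MeasurableSet B) (v : H) :
    E.proj B (E.proj B v) = E.proj B v := by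
  rw [E.proj_proj hB hB, Set.inter_self]

theorem proj_proj_of_disjoint (E : SpectralMeasure H) {A B : Set ℝ} (hA : MeasurableSet A)
    (hB : MeasurableSet B) (hAB : Disjoint A B) (v : H) : E.proj A (E.proj B v) = 0 := by
  rw [E.proj_proj hA hB, hAB.inter_eq, E.empty]
  rfl

theorem measureReal_scalarMeasure (E : SpectralMeasure H) {B : Set ℝ} (hB : MeasurableSet B)
    (v : H) : (E.scalarMeasure v).real B = ‖E.proj B v‖ ^ 2 := by
  rw [measureReal_def, E.scalarMeasure_apply v hB, E.inner_proj hB, Complex.ofReal_re,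
    ENNReal.toReal_ofReal (by positivity)]

theorem proj_union (E : SpectralMeasure H) {A B : Set ℝ} (hA : MeasurableSet A)
    (hB : MeasurableSet B) (hAB : Disjoint A B) (v : H) :
    E.proj (A ∪ B) v = E.proj A v + E.proj B v := by
  have h : E.proj (A ∪ B) = E.proj A + E.proj B := by
    refine ContinuousLinearMap.ext_of_inner_self fun x => ?_
    rw [add_apply, inner_add_right, E.inner_proj (hA.union hB), E.inner_proj hA, E.inner_proj hB,
      ← E.measureReal_scalarMeasure (hA.union hB), ← E.measureReal_scalarMeasure hA,
      ← E.measureReal_scalarMeasure hB, measureReal_union hAB hB]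
    push_cast
    rfl
  rw [h]
  rfl

theorem sum_proj (E : SpectralMeasure H) (v : H) :
    E.proj (Set.Ioi 0) v + E.proj (Set.Iio 0) v + E.proj {0} v = v := by
  have h1 : Disjoint (Set.Ioi (0 : ℝ)) (Set.Iio 0) := Set.Ioi_disjoint_Iio_same
  have h2 : Disjoint (Set.Ioi (0 : ℝ) ∪ Set.Iio 0) {0} := by simp
  rw [← E.proj_union measurableSet_Ioi measurableSet_Iio h1,
    ← E.proj_union (measurableSet_Ioi.union measurableSet_Iio) (measurableSet_singleton 0) h2]
  have h3 : Set.Ioi (0 : ℝ) ∪ Set.Iio 0 ∪ {0} = Set.univ := by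
    ext x
    simp only [Set.mem_union, Set.mem_Ioi, Set.mem_Iio, Set.mem_singleton_iff, Set.mem_univ,
      iff_true]
    rcases lt_trichotomy x 0 with h | h | h <;> simp [h]
  rw [h3, E.univ]
  rfl

theorem inner_proj_proj_of_disjoint (E : SpectralMeasure H) {A B : Set ℝ} (hA : MeasurableSet A)
    (hB : MeasurableSet B) (hAB : Disjoint A B) (v w : H) :
    ⟪E.proj A v, E.proj B w⟫_ℂ = 0 := by
  have h2 : ContinuousLinearMap.adjoint (E.proj A) = E.proj A := (E.isStarProjection A hA).isSelfAdjoint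
  rw [← h2, ContinuousLinearMap.adjoint_inner_left, E.proj_proj_of_disjoint hA hB hAB,
    inner_zero_right]

theorem norm_sq_eq_sum (E : SpectralMeasure H) (v : H) :
    ‖v‖ ^ 2 = ‖E.proj (Set.Ioi 0) v‖ ^ 2 + ‖E.proj (Set.Iio 0) v‖ ^ 2 + ‖E.proj {0} v‖ ^ 2 := by
  have h1 : Disjoint (Set.Ioi (0 : ℝ)) (Set.Iio 0) := Set.Ioi_disjoint_Iio_same
  have h := E.sum_proj v
  have e1 := E.inner_proj_proj_of_disjoint measurableSet_Ioi measurableSet_Iio h1 v v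
  have e2 := E.inner_proj_proj_of_disjoint measurableSet_Ioi (measurableSet_singleton 0)
    (by simp : Disjoint (Set.Ioi (0 : ℝ)) {0}) v v
  have e3 := E.inner_proj_proj_of_disjoint measurableSet_Iio (measurableSet_singleton 0)
    (by simp : Disjoint (Set.Iio (0 : ℝ)) {0}) v v
  conv_lhs => rw [← h]
  rw [norm_add_sq (𝕜 := ℂ), norm_add_sq (𝕜 := ℂ), inner_add_left, e1, e2, e3]
  simp

theorem mem_range_iff (E : SpectralMeasure H) {B : Set ℝ} (hB : MeasurableSet B) {v : H} :
    v ∈ E.range B ↔ E.proj B v = v := by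
  constructor
  · rintro ⟨w, rfl⟩
    exact E.proj_proj_self hB w
  · intro h
    exact ⟨v, h⟩

/-- An additive isometry that matches the norms of two families of spectral projections intertwines
them. -/
theorem proj_apply_of_norm_eq (E : SpectralMeasure H) {A B : Set ℝ} (hA : MeasurableSet A)
    (hB : MeasurableSet B) (S : H →+ H) (hS : ∀ v, ‖S v‖ = ‖v‖)
    (h : ∀ v, ‖E.proj A (S v)‖ = ‖E.proj B v‖) (v : H) : E.proj A (S v) = S (E.proj B v) := by
  -- Split `v` along `E.proj B`: matching norms kill the image of the complement and force the image
  -- of `E.proj B v` into the range of `E.proj A`. Additivity of `S` is enough, so antilinear maps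
  -- are covered.
  have h1 : E.proj A (S (v - E.proj B v)) = 0 := by
    rw [← norm_eq_zero, h, map_sub, E.proj_proj_self hB, sub_self, norm_zero]
  have h2 : E.proj A (S (E.proj B v)) = S (E.proj B v) := by
    set w := S (E.proj B v) with hw
    have h3 : ‖E.proj A w‖ = ‖w‖ := by rw [hw, h, E.proj_proj_self hB, hS]
    have h4 := E.inner_proj hA w
    have h5 : ‖w - E.proj A w‖ ^ 2 = 0 := by
      rw [norm_sub_sq (𝕜 := ℂ), h4, h3]
      simp only [RCLike.re_eq_complex_re, Complex.ofReal_re]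
      ring
    exact (sub_eq_zero.mp (norm_eq_zero.mp (pow_eq_zero_iff two_ne_zero |>.mp h5))).symm
  rw [map_sub, map_sub, sub_eq_zero] at h1
  rw [h1, h2]

theorem IsSpectralMeasureOf.proj_apply_of_inner_eq (hE : E.IsSpectralMeasureOf U) {B : Set ℝ}
    (hB : MeasurableSet B) (S : H →+ H) (hS : ∀ v, ‖S v‖ = ‖v‖)
    (h : ∀ t v, ⟪S v, U t (S v)⟫_ℂ = ⟪v, U t v⟫_ℂ) (v : H) :
    E.proj B (S v) = S (E.proj B v) := by
  refine E.proj_apply_of_norm_eq hB hB S hS (fun v => ?_) v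
  have h1 : E.scalarMeasure (S v) = E.scalarMeasure v := Measure.ext_of_charFun (funext fun t => by
    rw [hE.charFun_eq, hE.charFun_eq, h])
  rw [← sq_eq_sq₀ (norm_nonneg _) (norm_nonneg _), ← E.measureReal_scalarMeasure hB,
    ← E.measureReal_scalarMeasure hB, h1]

/-- Reversing time in the coefficient pushes the scalar measure forward under `x ↦ -x`. -/
theorem IsSpectralMeasureOf.proj_apply_of_inner_eq_neg (hE : E.IsSpectralMeasureOf U) {B : Set ℝ}
    (hB : MeasurableSet B) (S : H →+ H) (hS : ∀ v, ‖S v‖ = ‖v‖)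
    (h : ∀ t v, ⟪S v, U t (S v)⟫_ℂ = ⟪v, U (-t) v⟫_ℂ) (v : H) :
    E.proj B (S v) = S (E.proj ((fun x => -1 * x) ⁻¹' B) v) := by
  have hm : Measurable fun x : ℝ => -1 * x := measurable_const_mul (-1)
  refine E.proj_apply_of_norm_eq hB (hm hB) S hS (fun v => ?_) v
  have h1 : E.scalarMeasure (S v) = (E.scalarMeasure v).map (fun x => -1 * x) :=
    Measure.ext_of_charFun (funext fun t => by
      rw [charFun_map_mul, hE.charFun_eq, hE.charFun_eq, h, neg_one_mul])
  rw [← sq_eq_sq₀ (norm_nonneg _) (norm_nonneg _), ← E.measureReal_scalarMeasure hB,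
    ← E.measureReal_scalarMeasure (hm hB), h1, map_measureReal_apply hm hB]

theorem IsSpectralMeasureOf.proj_Ioi_apply (hE : E.IsSpectralMeasureOf U) {W : H ≃ₗᵢ[ℂ] H}
    (hW : ∀ t v, W (U t v) = U (-t) (W v)) (v : H) :
    E.proj (Set.Ioi 0) (W v) = W (E.proj (Set.Iio 0) v) := by
  have h := hE.proj_apply_of_inner_eq_neg (measurableSet_Ioi (a := 0)) (W : H →+ H) W.norm_map
    (fun t v => by
      change ⟪W v, U t (W v)⟫_ℂ = _
      rw [← neg_neg t, ← hW, W.inner_map_map, neg_neg]) v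
  have hs : (fun x : ℝ => -1 * x) ⁻¹' Set.Ioi 0 = Set.Iio 0 := by ext x; simp
  rw [hs] at h
  exact h

theorem IsSpectralMeasureOf.proj_Iio_apply (hE : E.IsSpectralMeasureOf U) {W : H ≃ₗᵢ[ℂ] H}
    (hW : ∀ t v, W (U t v) = U (-t) (W v)) (v : H) :
    E.proj (Set.Iio 0) (W v) = W (E.proj (Set.Ioi 0) v) := by
  have h := hE.proj_apply_of_inner_eq_neg (measurableSet_Iio (a := 0)) (W : H →+ H) W.norm_map
    (fun t v => by
      change ⟪W v, U t (W v)⟫_ℂ = _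
      rw [← neg_neg t, ← hW, W.inner_map_map, neg_neg]) v
  have hs : (fun x : ℝ => -1 * x) ⁻¹' Set.Iio 0 = Set.Ioi 0 := by ext x; simp
  rw [hs] at h
  exact h

/-- Two signs cancel: antilinearity swaps the inner product and `C` reverses time, so the scalar
measures are unchanged. -/
theorem IsSpectralMeasureOf.proj_apply_of_conj (hE : E.IsSpectralMeasureOf U) {C : H ≃ₗᵢ⋆[ℂ] H}
    (hC : ∀ t v, C (U t v) = U (-t) (C v)) {B : Set ℝ} (hB : MeasurableSet B) (v : H) :
    E.proj B (C v) = C (E.proj B v) :=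
  hE.proj_apply_of_inner_eq hB (C : H →+ H) C.norm_map (fun t v => by
    change ⟪C v, U t (C v)⟫_ℂ = _
    rw [← neg_neg t, ← hC, inner_map_map_of_conj, U.inner_apply_right, neg_neg]) v

/-- The scalar measure of such a vector `w` is concentrated at `0`, so `⟪w, U t w⟫ = ‖w‖ ^ 2`, which
forces `U t w = w`. -/
theorem IsSpectralMeasureOf.apply_proj_zero (hE : E.IsSpectralMeasureOf U) (t : ℝ) (v : H) :
    U t (E.proj {0} v) = E.proj {0} v := by
  set w := E.proj {0} v with hw
  have h1 : ∀ᵐ x ∂E.scalarMeasure w, x = 0 := by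
    have h2 : E.scalarMeasure w {0}ᶜ = 0 := by
      rw [E.scalarMeasure_apply w (measurableSet_singleton 0).compl, hw,
        E.proj_proj_of_disjoint (measurableSet_singleton 0).compl (measurableSet_singleton 0)
          disjoint_compl_left, inner_zero_right]
      simp
    exact h2
  have h3 : ⟪w, U t w⟫_ℂ = ⟪w, w⟫_ℂ := by
    have h4 := hE 0 w
    rw [U.map_zero] at h4
    rw [hE t, h4]
    refine integral_congr_ae ?_
    filter_upwards [h1] with x hx
    rw [hx]
    simp
  have h5 : ‖U t w - w‖ ^ 2 = 0 := by
    rw [norm_sub_rev, norm_sub_sq (𝕜 := ℂ), h3, (U t).norm_map, inner_self_eq_norm_sq (𝕜 := ℂ)]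
    ring
  exact sub_eq_zero.mp (norm_eq_zero.mp (pow_eq_zero_iff two_ne_zero |>.mp h5))

/-- The restriction of `W` works, since `W` exchanges the two spectral subspaces. `W` need not be an
involution, which allows `W = J ∘ C`. -/
theorem IsSpectralMeasureOf.equivalent_of_reversing (hE : E.IsSpectralMeasureOf U)
    {W : H ≃ₗᵢ[ℂ] H} (hW : ∀ t v, W (U t v) = U (-t) (W v)) :
    UnitaryRep.Equivalent hE.posPart hE.negPart := by
  have h1 : ∀ v ∈ E.range (Set.Ioi 0), W v ∈ E.range (Set.Iio 0) := by
    rintro _ ⟨v, rfl⟩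
    exact ⟨W v, hE.proj_Iio_apply hW v⟩
  have h2 : ∀ v ∈ E.range (Set.Iio 0), W.symm v ∈ E.range (Set.Ioi 0) := by
    intro v hv
    rw [E.mem_range_iff measurableSet_Iio] at hv
    rw [E.mem_range_iff measurableSet_Ioi]
    apply W.injective
    rw [← hE.proj_Iio_apply hW, W.apply_symm_apply, hv]
  refine ⟨{ toFun := fun v => ⟨W v, h1 v v.2⟩
            invFun := fun v => ⟨W.symm v, h2 v v.2⟩
            map_add' := fun v w => Subtype.ext (by simp)
            map_smul' := fun c v => Subtype.ext (by simp)
            left_inv := fun v => Subtype.ext (by simp)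
            right_inv := fun v => Subtype.ext (by simp)
            norm_map' := fun v => W.norm_map v }, fun t v => Subtype.ext (hW t v)⟩

/-- A unitary equivalence between the positive and the time-reversed negative spectral part, together
with a (semilinear) isometric involution commuting with the spectral projections, glues to a
(semilinear) isometric involution exchanging the two parts. -/
theorem IsSpectralMeasureOf.exists_involution {σ : ℂ →+* ℂ} [RingHomInvPair σ σ]
    (hE : E.IsSpectralMeasureOf U) (hEq : UnitaryRep.Equivalent hE.posPart hE.negPart)
    (C : H ≃ₛₗᵢ[σ] H) (hCC : ∀ v, C (C v) = v)
    (hCE : ∀ B, MeasurableSet B → ∀ v, E.proj B (C v) = C (E.proj B v)) {ε : ℝ}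
    (hCU : ∀ t v, C (U t v) = U (ε * t) (C v)) :
    ∃ J : H ≃ₛₗᵢ[σ] H, (∀ v, J (J v) = v) ∧ (∀ t v, J (U t v) = U (-(ε * t)) (J v)) ∧
      ∀ v, J (E.proj {0} v) = C (E.proj {0} v) := by
  obtain ⟨T, hT⟩ := hEq
  have hp : MeasurableSet (Set.Ioi (0 : ℝ)) := measurableSet_Ioi
  have hn : MeasurableSet (Set.Iio (0 : ℝ)) := measurableSet_Iio
  have hz : MeasurableSet ({0} : Set ℝ) := measurableSet_singleton 0
  have hpn : Disjoint (Set.Ioi (0 : ℝ)) (Set.Iio 0) := Set.Ioi_disjoint_Iio_same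
  have hpz : Disjoint (Set.Ioi (0 : ℝ)) {0} := by simp
  have hnz : Disjoint (Set.Iio (0 : ℝ)) {0} := by simp
  let P : H → E.range (Set.Ioi 0) := fun v => ⟨E.proj (Set.Ioi 0) v, v, rfl⟩
  let N : H → E.range (Set.Iio 0) := fun v => ⟨E.proj (Set.Iio 0) v, v, rfl⟩
  have hPadd : ∀ v w, P (v + w) = P v + P w := fun v w => Subtype.ext (map_add _ v w)
  have hNadd : ∀ v w, N (v + w) = N v + N w := fun v w => Subtype.ext (map_add _ v w)
  have hPsmul : ∀ (c : ℂ) v, P (c • v) = c • P v := fun c v => Subtype.ext (map_smul _ c v)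
  have hNsmul : ∀ (c : ℂ) v, N (c • v) = c • N v := fun c v => Subtype.ext (map_smul _ c v)
  -- `C` stands before `T` in one block and after `T.symm` in the other, so the product of the
  -- blocks collapses to `C ∘ C = 1` with no compatibility between `T` and `C`.
  let J : H → H := fun v => T (P (C v)) + C (T.symm (N v)) + C (E.proj {0} v)
  have hTn : ∀ x : E.range (Set.Ioi 0), E.proj (Set.Iio 0) (T x) = T x := fun x =>
    (E.mem_range_iff hn).mp (T x).2
  have hTp : ∀ x : E.range (Set.Iio 0), E.proj (Set.Ioi 0) (T.symm x) = T.symm x := fun x =>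
    (E.mem_range_iff hp).mp (T.symm x).2
  have hJp : ∀ v, E.proj (Set.Ioi 0) (J v) = C (T.symm (N v)) := fun v => by
    simp only [J, map_add]
    rw [hCE _ hp, hCE _ hp, hTp, E.proj_proj_of_disjoint hp hz hpz, map_zero, add_zero, ← hTn,
      E.proj_proj_of_disjoint hp hn hpn, zero_add]
  have hJn : ∀ v, E.proj (Set.Iio 0) (J v) = T (P (C v)) := fun v => by
    simp only [J, map_add]
    rw [hCE _ hn, hCE _ hn, ← hTp, E.proj_proj_of_disjoint hn hp hpn.symm,
      E.proj_proj_of_disjoint hn hz hnz, map_zero, add_zero, add_zero, hTn]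
  have hJz : ∀ v, E.proj {0} (J v) = C (E.proj {0} v) := fun v => by
    simp only [J, map_add]
    rw [hCE _ hz, hCE _ hz, ← hTp, E.proj_proj_of_disjoint hz hp hpz.symm, ← hTn,
      E.proj_proj_of_disjoint hz hn hnz.symm, map_zero, add_zero, zero_add, E.proj_proj_self hz]
  have hPC : ∀ v, (P (C v) : H) = C (P v) := fun v => hCE _ hp v
  have hnorm : ∀ v, ‖J v‖ = ‖v‖ := fun v => by
    rw [← sq_eq_sq₀ (norm_nonneg _) (norm_nonneg _), E.norm_sq_eq_sum, E.norm_sq_eq_sum v, hJp,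
      hJn, hJz, C.norm_map, C.norm_map, Submodule.norm_coe, Submodule.norm_coe, T.norm_map,
      T.symm.norm_map, ← Submodule.norm_coe, ← Submodule.norm_coe, hPC, C.norm_map]
    ring
  have hJJ : ∀ v, J (J v) = v := fun v => by
    have h1 : N (J v) = T (P (C v)) := Subtype.ext (hJn v)
    have h2 : P (C (J v)) = T.symm (N v) := Subtype.ext (by rw [hPC]; change C (E.proj _ (J v)) = _
                                                            rw [hJp, hCC])
    change (T (P (C (J v))) : H) + C (T.symm (N (J v))) + C (E.proj {0} (J v)) = v
    rw [h1, h2, T.apply_symm_apply, T.symm_apply_apply, hJz, hPC, hCC, hCC]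
    rw [add_comm (N v : H)]
    exact E.sum_proj v
  let Je : H ≃ₛₗᵢ[σ] H :=
    { toFun := J
      invFun := J
      map_add' := fun v w => by
        simp only [J, map_add, hPadd, hNadd, Submodule.coe_add]
        abel
      map_smul' := fun c v => by
        simp only [J, map_smulₛₗ, hPsmul, hNsmul, Submodule.coe_smul, RingHom.id_apply, smul_add]
      left_inv := hJJ
      right_inv := hJJ
      norm_map' := hnorm }
  refine ⟨Je, hJJ, fun t v => ?_, fun v => ?_⟩
  · have hTU : ∀ (s : ℝ) (w : H), (T (P (U s w)) : H) = U (-s) (T (P w)) := fun s w => by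
      have h1 : P (U s w) = hE.posPart s (P w) := Subtype.ext (hE.commute hp s w)
      rw [h1, hT]
      rfl
    have hTU' : ∀ (s : ℝ) (w : H), (T.symm (N (U s w)) : H) = U (-s) (T.symm (N w)) := fun s w => by
      have h1 : N (U s w) = hE.negPart (-s) (N w) := Subtype.ext (by
        refine (hE.commute hn s w).trans ?_
        change _ = U (- -s) (N w : H)
        rw [neg_neg])
      have h2 : T.symm (N (U s w)) = hE.posPart (-s) (T.symm (N w)) := by
        rw [LinearIsometryEquiv.symm_apply_eq, hT, T.apply_symm_apply, h1]
      rw [h2]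
      rfl
    change (T (P (C (U t v))) : H) + C (T.symm (N (U t v))) + C (E.proj {0} (U t v)) =
      U (-(ε * t)) (T (P (C v)) + C (T.symm (N v)) + C (E.proj {0} v))
    -- On the `{0}` component every `U s` is trivial, so the sign of time does not matter there.
    rw [hCU, hTU, hTU', hCU, hE.commute hz, hE.apply_proj_zero, map_add, map_add, ← hCE _ hz,
      hE.apply_proj_zero, mul_neg]
  · change (T (P (C (E.proj {0} v))) : H) + C (T.symm (N (E.proj {0} v))) +
      C (E.proj {0} (E.proj {0} v)) = _
    have h1 : N (E.proj {0} v) = 0 := Subtype.ext (E.proj_proj_of_disjoint hn hz hnz v)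
    have h2 : P (C (E.proj {0} v)) = 0 := Subtype.ext (by
      rw [hPC]
      change C (E.proj _ (E.proj {0} v)) = 0
      rw [E.proj_proj_of_disjoint hp hz hpz, map_zero])
    rw [h1, h2, map_zero, map_zero, E.proj_proj_self hz]
    simp

end SpectralMeasure

/-! ### Reproducing kernel spaces: reflection, compressions and cyclic operators. -/

section GNS

variable {V : Type u} [NormedAddCommGroup V] [InnerProductSpace ℂ V] [CompleteSpace V]
  (ψ : ℝ → (V →L[ℂ] V)) [Fact (IsPositiveDefinite ψ)]

theorem GNSSpace.kerFun_apply (t : ℝ) (v : V) (s : ℝ) :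
    (RKHS.kerFun (GNSSpace ψ) t v) s = ψ (s - t) v := by
  rw [RKHS.kerFun_apply, RKHS.OfKernel.kernel_ofKernel]
  rfl

theorem GNSSpace.inner_kerFun_kerFun (s t : ℝ) (v w : V) :
    ⟪RKHS.kerFun (GNSSpace ψ) s v, RKHS.kerFun (GNSSpace ψ) t w⟫_ℂ = ⟪ψ (t - s) v, w⟫_ℂ := by
  rw [← RKHS.kernel_inner, RKHS.OfKernel.kernel_ofKernel]
  rfl

theorem GNSSpace.dense_span_kerFun :
    Dense (Submodule.span ℂ (Set.range fun p : ℝ × V => RKHS.kerFun (GNSSpace ψ) p.1 p.2) :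
      Set (GNSSpace ψ)) := by
  have h := RKHS.kerFun_dense (GNSSpace ψ)
  rw [← Submodule.dense_iff_topologicalClosure_eq_top] at h
  refine h.mono (Submodule.span_mono ?_)
  rintro _ ⟨x, v, rfl⟩
  exact ⟨(x, v), rfl⟩

theorem gnsRep_kerFun (s t : ℝ) (v : V) :
    gnsRep ψ t (RKHS.kerFun (GNSSpace ψ) s v) = RKHS.kerFun (GNSSpace ψ) (s - t) v := by
  refine RKHS.ext fun x => ?_
  rw [gnsRep_apply, GNSSpace.kerFun_apply, GNSSpace.kerFun_apply, sub_sub_eq_add_sub]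

/-- For a symmetric positive definite function, the reflection `f ↦ f (-·)` is a unitary involution
of the reproducing kernel space. -/
theorem GNSSpace.exists_reflection (hψ : ∀ t, ψ (-t) = ψ t) :
    ∃ Q : GNSSpace ψ ≃ₗᵢ[ℂ] GNSSpace ψ, (∀ f, Q (Q f) = f) ∧
      ∀ (t : ℝ) (f : GNSSpace ψ), Q (gnsRep ψ t (Q f)) = gnsRep ψ (-t) f := by
  have hd := GNSSpace.dense_span_kerFun ψ
  have hd' : Dense (Submodule.span ℂ (Set.range fun p : ℝ × V =>
      RKHS.kerFun (GNSSpace ψ) (-p.1) p.2) : Set (GNSSpace ψ)) := by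
    convert hd using 3
    exact (Equiv.prodCongr (Equiv.neg ℝ) (Equiv.refl V)).surjective.range_comp
      (fun p : ℝ × V => RKHS.kerFun (GNSSpace ψ) p.1 p.2)
  -- Negating both base points negates the argument of `ψ`; symmetry says that the Gram matrix does
  -- not notice.
  obtain ⟨Q, hQ⟩ := exists_linearIsometryEquiv_of_inner_eq (σ := RingHom.id ℂ) (by simp) (by simp)
    (fun p : ℝ × V => RKHS.kerFun (GNSSpace ψ) p.1 p.2)
    (fun p : ℝ × V => RKHS.kerFun (GNSSpace ψ) (-p.1) p.2) hd hd' (fun p q => by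
      rw [GNSSpace.inner_kerFun_kerFun, GNSSpace.inner_kerFun_kerFun, RingHom.id_apply,
        ← hψ (q.1 - p.1)]
      congr 3
      ring)
  have hQ' : ∀ (t : ℝ) (v : V), Q (RKHS.kerFun (GNSSpace ψ) t v) =
      RKHS.kerFun (GNSSpace ψ) (-t) v := fun t v => hQ (t, v)
  let Qc : GNSSpace ψ →L[ℂ] GNSSpace ψ := Q.toContinuousLinearEquiv
  refine ⟨Q, fun f => ?_, fun t f => ?_⟩
  · have h : Qc.comp Qc = ContinuousLinearMap.id ℂ (GNSSpace ψ) := by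
      refine ContinuousLinearMap.ext_on hd ?_
      rintro _ ⟨⟨s, v⟩, rfl⟩
      change Q (Q (RKHS.kerFun (GNSSpace ψ) s v)) = RKHS.kerFun (GNSSpace ψ) s v
      rw [hQ', hQ', neg_neg]
    exact congrArg (fun T : GNSSpace ψ →L[ℂ] GNSSpace ψ => T f) h
  · have h : Qc.comp (((gnsRep ψ t).toContinuousLinearEquiv :
        GNSSpace ψ →L[ℂ] GNSSpace ψ).comp Qc) = (gnsRep ψ (-t)).toContinuousLinearEquiv := by
      refine ContinuousLinearMap.ext_on hd ?_
      rintro _ ⟨⟨s, v⟩, rfl⟩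
      change Q (gnsRep ψ t (Q (RKHS.kerFun (GNSSpace ψ) s v))) =
        gnsRep ψ (-t) (RKHS.kerFun (GNSSpace ψ) s v)
      rw [hQ', gnsRep_kerFun, hQ', gnsRep_kerFun]
      congr 2
      ring
    exact congrArg (fun T : GNSSpace ψ →L[ℂ] GNSSpace ψ => T f) h

end GNS

namespace UnitaryRep

variable {H : Type u} [NormedAddCommGroup H] [InnerProductSpace ℂ H] [CompleteSpace H]

/-- The double sum is the squared norm of `∑ j, U (-t j) (A (v j))`. -/
theorem isPositiveDefinite_compression {V : Type u} [NormedAddCommGroup V] [InnerProductSpace ℂ V]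
    [CompleteSpace V] (U : UnitaryRep H) (A : V →L[ℂ] H) :
    IsPositiveDefinite fun t => (ContinuousLinearMap.adjoint A).comp
      (((U t).toContinuousLinearEquiv : H →L[ℂ] H).comp A) := by
  intro n t v
  have h : ∑ j, ∑ k, ⟪v j, ((ContinuousLinearMap.adjoint A).comp
      (((U (t j - t k)).toContinuousLinearEquiv : H →L[ℂ] H).comp A)) (v k)⟫_ℂ =
      ⟪∑ j, U (-t j) (A (v j)), ∑ j, U (-t j) (A (v j))⟫_ℂ := by
    simp only [sum_inner, inner_sum]
    rw [Finset.sum_comm]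
    refine Finset.sum_congr rfl fun j _ => Finset.sum_congr rfl fun k _ => ?_
    change ⟪v k, ContinuousLinearMap.adjoint A (U (t k - t j) (A (v j)))⟫_ℂ = _
    rw [ContinuousLinearMap.adjoint_inner_right, U.inner_apply_apply]
    congr 3
    ring
  rw [h, inner_self_eq_norm_sq_to_K]
  norm_cast
  positivity

/-- A unitary representation with a cyclic operator `A` is the GNS representation of the compression
`t ↦ A† U t A`. -/
theorem equivalent_gnsRep {V : Type u} [NormedAddCommGroup V] [InnerProductSpace ℂ V]
    [CompleteSpace V] (U : UnitaryRep H) (A : V →L[ℂ] H)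
    (hA : ∀ z, (∀ t x, ⟪z, U t (A x)⟫_ℂ = 0) → z = 0)
    [Fact (IsPositiveDefinite fun t => (ContinuousLinearMap.adjoint A).comp
      (((U t).toContinuousLinearEquiv : H →L[ℂ] H).comp A))] :
    Equivalent U (gnsRep fun t => (ContinuousLinearMap.adjoint A).comp
      (((U t).toContinuousLinearEquiv : H →L[ℂ] H).comp A)) := by
  set ψ : ℝ → (V →L[ℂ] V) := fun t => (ContinuousLinearMap.adjoint A).comp
    (((U t).toContinuousLinearEquiv : H →L[ℂ] H).comp A) with hψ
  have hψ' : ∀ t v, ψ t v = ContinuousLinearMap.adjoint A (U t (A v)) := fun t v => rfl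
  have hd : Dense (Submodule.span ℂ (Set.range fun p : ℝ × V => U (-p.1) (A p.2)) : Set H) := by
    rw [Submodule.dense_iff_topologicalClosure_eq_top, Submodule.topologicalClosure_eq_top_iff,
      Submodule.eq_bot_iff]
    intro z hz
    refine hA z fun t x => (Submodule.mem_orthogonal' _ _).mp hz _ (Submodule.subset_span ?_)
    exact ⟨(-t, x), by simp⟩
  -- The sign in `U (-p.1)` matches the right translation action, which moves the kernel function at
  -- `s` to `s - t`.
  obtain ⟨T, hT⟩ := exists_linearIsometryEquiv_of_inner_eq (σ := RingHom.id ℂ) (by simp) (by simp)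
    (fun p : ℝ × V => U (-p.1) (A p.2)) (fun p : ℝ × V => RKHS.kerFun (GNSSpace ψ) p.1 p.2) hd
    (GNSSpace.dense_span_kerFun ψ) (fun p q => by
      rw [GNSSpace.inner_kerFun_kerFun, RingHom.id_apply, hψ',
        ContinuousLinearMap.adjoint_inner_left, U.inner_apply_apply, U.inner_apply_right]
      congr 3
      ring)
  have hT' : ∀ (t : ℝ) (v : V), T (U (-t) (A v)) = RKHS.kerFun (GNSSpace ψ) t v :=
    fun t v => hT (t, v)
  refine ⟨T, fun t x => ?_⟩
  have h : ((T.toContinuousLinearEquiv : H →L[ℂ] GNSSpace ψ).comp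
      ((U t).toContinuousLinearEquiv : H →L[ℂ] H)) =
      ((gnsRep ψ t).toContinuousLinearEquiv : GNSSpace ψ →L[ℂ] GNSSpace ψ).comp
        (T.toContinuousLinearEquiv : H →L[ℂ] GNSSpace ψ) := by
    refine ContinuousLinearMap.ext_on hd ?_
    rintro _ ⟨⟨s, v⟩, rfl⟩
    change T (U t (U (-s) (A v))) = gnsRep ψ t (T (U (-s) (A v)))
    rw [hT', gnsRep_kerFun, ← hT', ← U.map_add]
    congr 3
    ring
  exact congrArg (fun S : H →L[ℂ] GNSSpace ψ => S x) h

end UnitaryRep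

/-! ### From a reversing involution to a symmetric positive definite function. -/

namespace SpectralMeasure

variable {H : Type u} [NormedAddCommGroup H] [InnerProductSpace ℂ H] [CompleteSpace H]
  {E : SpectralMeasure H} {U : UnitaryRep H}

theorem IsSpectralMeasureOf.proj_eq_spectralProj (hE : E.IsSpectralMeasureOf U)
    (hU : U.IsStronglyContinuous) {B : Set ℝ} (hB : MeasurableSet B) :
    E.proj B = UnitaryRep.spectralProj hU B := by
  refine ContinuousLinearMap.ext_of_inner_self fun x => ?_
  have h : E.scalarMeasure x = UnitaryRep.measureAt hU x :=
    Measure.ext_of_charFun (funext fun t => by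
      rw [hE.charFun_eq, UnitaryRep.charFun_measureAt])
  rw [UnitaryRep.inner_spectralProj_self, E.inner_proj hB, ← E.measureReal_scalarMeasure hB, h]

/-- A vector orthogonal to an orbit is orthogonal to its spectral components. -/
theorem IsSpectralMeasureOf.inner_proj_eq_zero (hE : E.IsSpectralMeasureOf U)
    (hU : U.IsStronglyContinuous) {B : Set ℝ} (hB : MeasurableSet B) {z y : H}
    (h : ∀ t, ⟪z, U t y⟫_ℂ = 0) : ⟪z, E.proj B y⟫_ℂ = 0 := by
  rw [hE.proj_eq_spectralProj hU hB, UnitaryRep.inner_spectralProj]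
  exact UnitaryRep.polarForm_eq hU (charFunGraph B).zero_mem h

/-- A unitary involution reversing time and fixing the invariant vectors presents `U` as the GNS
representation of a symmetric positive definite function. -/
theorem IsSpectralMeasureOf.exists_symmetric_gnsRep (hE : E.IsSpectralMeasureOf U)
    (hU : U.IsStronglyContinuous) {R : H ≃ₗᵢ[ℂ] H} (hRR : ∀ v, R (R v) = v)
    (hRU : ∀ t v, R (U t v) = U (-t) (R v)) (hRz : ∀ v, R (E.proj {0} v) = E.proj {0} v) :
    ∃ (ψ : ℝ → (H →L[ℂ] H)) (_ : Fact (IsPositiveDefinite ψ)),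
      (∀ t : ℝ, ψ (-t) = ψ t) ∧ UnitaryRep.Equivalent U (gnsRep ψ) := by
  -- `1 + R` takes values in the `R`-fixed vectors, which makes the compression even in `t`.
  let A : H →L[ℂ] H := ContinuousLinearMap.id ℂ H + (R.toContinuousLinearEquiv : H →L[ℂ] H)
  have hA : ∀ v, A v = v + R v := fun v => rfl
  have hRA : ∀ v, R (A v) = A v := fun v => by rw [hA, map_add, hRR, add_comm]
  have hpd : Fact (IsPositiveDefinite fun t => (ContinuousLinearMap.adjoint A).comp
      (((U t).toContinuousLinearEquiv : H →L[ℂ] H).comp A)) :=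
    ⟨U.isPositiveDefinite_compression A⟩
  have hp : MeasurableSet (Set.Ioi (0 : ℝ)) := measurableSet_Ioi
  have hn : MeasurableSet (Set.Iio (0 : ℝ)) := measurableSet_Iio
  have hpn : Disjoint (Set.Ioi (0 : ℝ)) (Set.Iio 0) := Set.Ioi_disjoint_Iio_same
  refine ⟨_, hpd, fun t => ?_, U.equivalent_gnsRep A fun z hz => ?_⟩
  · refine ContinuousLinearMap.ext fun y => ext_inner_left ℂ fun x => ?_
    change ⟪x, ContinuousLinearMap.adjoint A (U (-t) (A y))⟫_ℂ =
      ⟪x, ContinuousLinearMap.adjoint A (U t (A y))⟫_ℂ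
    rw [ContinuousLinearMap.adjoint_inner_right, ContinuousLinearMap.adjoint_inner_right,
      ← R.inner_map_map (A x) (U t (A y)), hRU, hRA, hRA]
  -- For `y` in the positive part, `A y = y + R y` with `R y` in the negative part, so a spectral
  -- projection recovers `y` from `A y`.
  · have h1 : ∀ x, ⟪z, E.proj (Set.Ioi 0) x⟫_ℂ = 0 := fun x => by
      have h := hE.inner_proj_eq_zero hU hp fun t => hz t (E.proj (Set.Ioi 0) x)
      rwa [hA, map_add, hE.proj_Ioi_apply hRU, E.proj_proj_self hp,
        E.proj_proj_of_disjoint hn hp hpn.symm, map_zero, add_zero] at h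
    have h2 : ∀ x, ⟪z, E.proj (Set.Iio 0) x⟫_ℂ = 0 := fun x => by
      have h := hE.inner_proj_eq_zero hU hn fun t => hz t (E.proj (Set.Iio 0) x)
      rwa [hA, map_add, hE.proj_Iio_apply hRU, E.proj_proj_self hn,
        E.proj_proj_of_disjoint hp hn hpn, map_zero, add_zero] at h
    -- Here `hRz` is essential: it makes `A` equal to `2` on the invariant vectors, whereas `R = -1`
    -- there would give `A = 0`.
    have h3 : ∀ x, ⟪z, E.proj {0} x⟫_ℂ = 0 := fun x => by
      have h := hz 0 (E.proj {0} x)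
      rw [U.map_zero, hA, hRz, inner_add_right, ← two_mul] at h
      exact (mul_eq_zero.mp h).resolve_left two_ne_zero
    refine (inner_self_eq_zero (𝕜 := ℂ)).mp ?_
    conv_lhs => rw [← E.sum_proj z]
    have h4 : ⟪z, E.proj (Set.Ioi 0) z + E.proj (Set.Iio 0) z + E.proj {0} z⟫_ℂ = 0 := by
      rw [inner_add_right, inner_add_right, h1, h2, h3, add_zero, add_zero]
    rw [E.sum_proj z] at h4 ⊢
    exact h4

end SpectralMeasure

end

/-! ### The equivalences. -/

/-- Let `U` be a (strongly continuous) unitary one-parameter group on a complex Hilbert space. It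
has a unique spectral measure `E`, and for this `E` the four conditions are equivalent. -/
theorem proposition3p1 {H : Type u} [NormedAddCommGroup H] [InnerProductSpace ℂ H]
    [CompleteSpace H] (U : UnitaryRep H) (hU : U.IsStronglyContinuous) :
    (∃! E : SpectralMeasure H, E.IsSpectralMeasureOf U) ∧
    ∀ (E : SpectralMeasure H) (hE : E.IsSpectralMeasureOf U),
      List.TFAE [
        ∃ J : H ≃ₗᵢ⋆[ℂ] H, (∀ v, J (J v) = v) ∧ ∀ (t : ℝ) (v : H), J (U t (J v)) = U t v,
        UnitaryRep.Equivalent hE.posPart hE.negPart,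
        ∃ (V : Type u) (_ : NormedAddCommGroup V) (_ : InnerProductSpace ℂ V)
          (_ : CompleteSpace V) (ψ : ℝ → (V →L[ℂ] V)) (_ : Fact (IsPositiveDefinite ψ)),
          (∀ t : ℝ, ψ (-t) = ψ t) ∧ UnitaryRep.Equivalent U (gnsRep ψ),
        ∃ R : H ≃ₗᵢ[ℂ] H, (∀ v, R (R v) = v) ∧ ∀ (t : ℝ) (v : H), R (U t (R v)) = U (-t) v] := by
  refine ⟨?_, fun E hE => ?_⟩
  · obtain ⟨E, hE⟩ := UnitaryRep.exists_isSpectralMeasureOf hU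
    exact ⟨E, hE, fun F hF => hF.unique hE⟩
  obtain ⟨C, hCC, hCU⟩ := U.exists_conjugation
  -- Gluing with the identity gives an involution that also fixes the invariant vectors, as the GNS
  -- construction requires.
  have hinv : UnitaryRep.Equivalent hE.posPart hE.negPart →
      ∃ R : H ≃ₗᵢ[ℂ] H, (∀ v, R (R v) = v) ∧ (∀ t v, R (U t v) = U (-t) (R v)) ∧
        ∀ v, R (E.proj {0} v) = E.proj {0} v := fun h => by
    obtain ⟨R, hRR, hRU, hRz⟩ := hE.exists_involution h (LinearIsometryEquiv.refl ℂ H)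
      (fun _ => rfl) (fun _ _ _ => rfl) (ε := 1) (fun t v => by rw [one_mul]; rfl)
    exact ⟨R, hRR, fun t v => by rw [hRU, one_mul], hRz⟩
  tfae_have 1 → 2 := by
    rintro ⟨J, hJJ, hJU⟩
    -- The composite of two antiunitaries is linear, and it reverses time because `C` does and `J`
    -- commutes with `U`.
    refine hE.equivalent_of_reversing (W := C.trans J) fun t v => ?_
    change J (C (U t v)) = U (-t) (J (C v))
    rw [hCU, ← hJU, hJJ]
  tfae_have 2 → 1 := by
    intro h
    -- With `ε = -1` the reversal by `C` cancels the one produced by gluing, so `J` commutes with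
    -- `U`.
    obtain ⟨J, hJJ, hJU, -⟩ := hE.exists_involution h C hCC
      (fun B hB v => hE.proj_apply_of_conj hCU hB v) (ε := -1)
      (fun t v => by rw [neg_one_mul, hCU])
    refine ⟨J, hJJ, fun t v => ?_⟩
    rw [hJU, hJJ, neg_one_mul, neg_neg]
  tfae_have 2 → 3 := by
    intro h
    obtain ⟨R, hRR, hRU, hRz⟩ := hinv h
    obtain ⟨ψ, hψ, hsymm, heq⟩ := hE.exists_symmetric_gnsRep hU hRR hRU hRz
    exact ⟨H, inferInstance, inferInstance, inferInstance, ψ, hψ, hsymm, heq⟩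
  tfae_have 3 → 4 := by
    rintro ⟨V, _, _, _, ψ, hψ, hsymm, T, hT⟩
    obtain ⟨Q, hQQ, hQ⟩ := GNSSpace.exists_reflection ψ hsymm
    refine ⟨(T.trans Q).trans T.symm, fun v => ?_, fun t v => ?_⟩
    · change T.symm (Q (T (T.symm (Q (T v))))) = v
      rw [T.apply_symm_apply, hQQ, T.symm_apply_apply]
    · change T.symm (Q (T (U t (T.symm (Q (T v)))))) = U (-t) v
      rw [hT, T.apply_symm_apply, hQ, ← hT, T.symm_apply_apply]
  tfae_have 4 → 2 := by
    rintro ⟨R, hRR, hRU⟩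
    refine hE.equivalent_of_reversing (W := R) fun t v => ?_
    rw [← hRU, hRR]
  tfae_finish
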